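/- Let $\mathbb{H}$ be the quaternions, $\mathbb{S}=\{I\in\mathbb{H}: I^2=-1\}$, and $\Omega_I=\Omega\cap(\mathbb{R}+I\mathbb{R})$ for $\Omega\subseteq\mathbb{H}$ and $I\in\mathbb{S}$. A symmetric slice domain is a nonempty connected open set $\Omega\subseteq\mathbb{H}$ that meets $\mathbb{R}$, such that every $\Omega_I$ is connected, and which contains the sphere $x+y\mathbb{S}=\{x+yJ : J\in\mathbb{S}\}$ whenever it contains a point $x+yI$ ($x,y\in\mathbb{R}$, $I\in\mathbb{S}$). A function $f:\Omega\to\mathbb{H}$ is regular if for all $I\in\mathbb{S}$ its restriction $f_I$ to $\Omega_I$ is $C^1$ with $\frac12(\partial_x+I\partial_y)f_I(x+Iy)=0$. A holomorphic function $\varphi$ on $\Omega_I$ (one satisfying this condition for the given $I$) has a unique regular extension $\mathrm{ext}(\varphi)$ to $\Omega$, namely $\mathrm{ext}(\varphi)(x+Jy)=\frac{1-JI}{2}\varphi(x+Iy)+\frac{1+JI}{2}\varphi(x-Iy)$. For regular $f,g$ and orthogonal $I,J\in\mathbb{S}$, write $f_I=F+GJ$, $g_I=H+KJ$ with $F,G,H,K:\Omega_I\to\mathbb{R}+I\mathbb{R}$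 holomorphic; then (independently of $I,J$) $$f*g=\mathrm{ext}\Big(\big[F(z)H(z)-G(z)\overline{K(\bar z)}\big]+\big[F(z)K(z)+G(z)\overline{H(\bar z)}\big]J\Big),\quad f^c=\mathrm{ext}\big(\overline{F(\bar z)}-G(z)J\big),\quad f^s=f*f^c,$$ and, for $f\not\equiv0$, $f^{-*}=\frac1{f^s}f^c$ on $\Omega\setminus Z_{f^s}$, where $Z_h$ denotes the zero set of $h$ in $\Omega$. For $p\in\mathbb{H}$ and $n\in\mathbb{N}$ let $(q-p)^{*n}$ be the $n$-th $*$-power of $q\mapsto q-p$ and $(q-p)^{*(-n)}$ its regular reciprocal (with value $(\bar p-p)^{-n}$ at $q=\bar p$ if $p\notin\mathbb{R}$). The classical multiplicity $m_f(p)$ of a regular $f\not\equiv0$ at $p\in\Omega$ is the largest $n\in\mathbb{N}$ with $f(q)=(q-p)^{*n}*h(q)$ for some regular $h:\Omega\to\mathbb{H}$. If $p,q$ lie on a common line $\mathbb{R}+I\mathbb{R}$, set $\sigma(q,p)=\tau(q,p)=|q-p|$; otherwise $$\sigma(q,p)=\sqrt{(\mathrm{Re}\,q-\mathrm{Re}\,p)^2+(|\mathrm{Im}\,q|+|\mathrm{Im}\,p|)^2},\quad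 \tau(q,p)=\sqrt{(\mathrm{Re}\,q-\mathrm{Re}\,p)^2+(|\mathrm{Im}\,q|-|\mathrm{Im}\,p|)^2}.$$ Let $\Sigma(p,0,R)=\{q:\tau(q,p)>0,\ \sigma(q,p)<R\}$. A point $p\in\mathbb{H}$ is a singularity of a regular function $f$ on a symmetric slice domain $\Omega'$ if $\Sigma(p,0,R)\subseteq\Omega'$ for some $R>0$. It is a pole if the Laurent expansion $f(q)=\sum_{n\in\mathbb{Z}}(q-p)^{*n}a_n$ on $\Sigma(p,0,R)$ satisfies, for some $m\ge0$, $a_{-k}=0$ for all $k>m$; the least such $m$ is its order $\mathrm{ord}_f(p)$ (so order $0$ is allowed). It is removable if $f$ extends to a neighborhood of $p$ as a regular function. A function $f$ is semiregular in $\Omega$ if it is regular on a symmetric slice domain $\Omega'\subseteq\Omega$ such that every point of $\Omega\setminus\Omega'$ is a pole or a removable singularity of $f$. **Proposition.** Let $f,g$ be regular functions on a symmetric slice domain $\Omega$ with $f\not\equiv0$, and consider $f^{-*}*g:\Omega\setminus Z_{f^s}\to\mathbb{H}$. Then every $p\in Z_{f^s}$ is a pole of $f^{-*}*g$, of order $$\mathrm{ord}_{f^{-*}*g}(p)\le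 m_{f^s}(p)<\infty.$$ Moreover $\Omega\setminus Z_{f^s}$ is a symmetric slice domain on which $f^{-*}*g$ is regular; hence $f^{-*}*g$ is semiregular in $\Omega$. -/

import Mathlib

open scoped Quaternion

noncomputable section

namespace SliceRegular

/-! ### Slices, symmetric slice domains, regular functions -/

/-- The 2-sphere `𝕊` of imaginary units of `ℍ`. -/
def imagUnits : Set ℍ[ℝ] := {I | I ^ 2 = -1}

/-- The point `x + I y` of the complex line `ℝ + I ℝ`, where `z = x + i y` is a complex number. -/
def slicePoint (I : ℍ[ℝ]) (z : ℂ) : ℍ[ℝ] := (z.re : ℍ[ℝ]) + I * (z.im : ℍ[ℝ])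

/-- The slice `Ω_I = Ω ∩ (ℝ + I ℝ)`, seen as a subset of `ℂ` through `x + i y ↦ x + I y`. -/
def slice (Ω : Set ℍ[ℝ]) (I : ℍ[ℝ]) : Set ℂ := slicePoint I ⁻¹' Ω

/-- Axially symmetric sets: with `x + I y` they contain the whole sphere `x + y 𝕊`. -/
def IsAxiallySymmetric (T : Set ℍ[ℝ]) : Prop :=
  ∀ I ∈ imagUnits, ∀ z : ℂ, slicePoint I z ∈ T → ∀ J ∈ imagUnits, slicePoint J z ∈ T

/-- Symmetric slice domains: axially symmetric domains (nonempty connected open sets) of `ℍ` that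
intersect the real axis and whose intersection with every complex line `ℝ + I ℝ` is a domain of
that line. -/
structure IsSymmetricSliceDomain (Ω : Set ℍ[ℝ]) : Prop where
  isOpen : IsOpen Ω
  isConnected : IsConnected Ω
  meets_real : ∃ r : ℝ, (r : ℍ[ℝ]) ∈ Ω
  isOpen_slice : ∀ I ∈ imagUnits, IsOpen (slice Ω I)
  isConnected_slice : ∀ I ∈ imagUnits, IsConnected (slice Ω I)
  symmetric : IsAxiallySymmetric Ω

/-- Slice regular functions on an open set `Ω`: for every `I ∈ 𝕊` the restriction
`f_I (x + I y)` is of class `C¹` on `Ω_I` and satisfies `(1/2) (∂/∂x + I ∂/∂y) f_I = 0` there.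
(Only the values of `f` on `Ω` matter.) -/
def IsRegularOn (Ω : Set ℍ[ℝ]) (f : ℍ[ℝ] → ℍ[ℝ]) : Prop :=
  ∀ I ∈ imagUnits,
    ContDiffOn ℝ 1 (fun z : ℂ => f (slicePoint I z)) (slice Ω I) ∧
    ∀ z ∈ slice Ω I,
      (1 / 2 : ℝ) • (fderiv ℝ (fun w : ℂ => f (slicePoint I w)) z 1
        + I * fderiv ℝ (fun w : ℂ => f (slicePoint I w)) z Complex.I) = 0

/-- The zero set `Z_f` of a function on `Ω`. -/
def zeroSet (Ω : Set ℍ[ℝ]) (f : ℍ[ℝ] → ℍ[ℝ]) : Set ℍ[ℝ] := {q ∈ Ω | f q = 0}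

/-! ### Splitting, regular extension, `*`-product

The splitting is done with respect to the orthogonal imaginary units `I = i`, `J = j`. -/

/-- The imaginary unit `i`. -/
def unitI : ℍ[ℝ] := ⟨0, 1, 0, 0⟩

/-- The imaginary unit `j`. -/
def unitJ : ℍ[ℝ] := ⟨0, 0, 1, 0⟩

@[simp] theorem unitI_re : unitI.re = 0 := rfl
@[simp] theorem unitI_imI : unitI.imI = 1 := rfl
@[simp] theorem unitI_imJ : unitI.imJ = 0 := rfl
@[simp] theorem unitI_imK : unitI.imK = 0 := rfl
@[simp] theorem unitJ_re : unitJ.re = 0 := rfl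
@[simp] theorem unitJ_imI : unitJ.imI = 0 := rfl
@[simp] theorem unitJ_imJ : unitJ.imJ = 1 := rfl
@[simp] theorem unitJ_imK : unitJ.imK = 0 := rfl

/-- The component `F` of the splitting `f_i = F + G j`, with `F, G` valued in `ℝ + i ℝ ≅ ℂ`. -/
def splitF (f : ℍ[ℝ] → ℍ[ℝ]) (z : ℂ) : ℂ :=
  ⟨(f (slicePoint unitI z)).re, (f (slicePoint unitI z)).imI⟩

/-- The component `G` of the splitting `f_i = F + G j`, with `F, G` valued in `ℝ + i ℝ ≅ ℂ`. -/
def splitG (f : ℍ[ℝ] → ℍ[ℝ]) (z : ℂ) : ℂ :=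
  ⟨(f (slicePoint unitI z)).imJ, (f (slicePoint unitI z)).imK⟩

/-- The splitting of `f_i`. -/
theorem splitting (f : ℍ[ℝ] → ℍ[ℝ]) (z : ℂ) :
    f (slicePoint unitI z)
      = slicePoint unitI (splitF f z) + slicePoint unitI (splitG f z) * unitJ := by
  ext <;> simp [slicePoint, splitF, splitG]

/-- The regular extension `ext(φ)` of a holomorphic function `φ` on the slice `Ω_i`, given by the
representation formula
`ext(φ)(x + J y) = (1 - J i)/2 φ(x + i y) + (1 + J i)/2 φ(x - i y)`.
Here `y = |Im q|` and `J = Im q / |Im q|`; if `q = x` is real then `y = 0` and the value is `φ(x)`,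
whatever `J`. -/
def regularExt (φ : ℂ → ℍ[ℝ]) (q : ℍ[ℝ]) : ℍ[ℝ] :=
  let J : ℍ[ℝ] := ‖q.im‖⁻¹ • q.im
  (1 / 2 : ℝ) • ((1 - J * unitI) * φ ⟨q.re, ‖q.im‖⟩ + (1 + J * unitI) * φ ⟨q.re, -‖q.im‖⟩)

/-- The `*`-product: if `f_i = F + G j` and `g_i = H + K j`, then `f * g` is the regular extension
of `[F(z) H(z) - G(z) conj(K(conj z))] + [F(z) K(z) + G(z) conj(H(conj z))] j`. -/
def starProd (f g : ℍ[ℝ] → ℍ[ℝ]) : ℍ[ℝ] → ℍ[ℝ] :=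
  regularExt fun z =>
    slicePoint unitI
        (splitF f z * splitF g z - splitG f z * star (splitG g (star z)))
      + slicePoint unitI
        (splitF f z * splitG g z + splitG f z * star (splitF g (star z))) * unitJ

/-- The regular conjugate `f^c`: the regular extension of `conj(F(conj z)) - G(z) j`. -/
def regularConj (f : ℍ[ℝ] → ℍ[ℝ]) : ℍ[ℝ] → ℍ[ℝ] :=
  regularExt fun z =>
    slicePoint unitI (star (splitF f (star z))) - slicePoint unitI (splitG f z) * unitJ

/-- The symmetrization `f^s = f * f^c`. -/
def symmetrization (f : ℍ[ℝ] → ℍ[ℝ]) : ℍ[ℝ] → ℍ[ℝ] := starProd f (regularConj f)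

/-- The regular reciprocal `f^{-*} = (1 / f^s) f^c`, meaningful outside the zeros of `f^s`. -/
def regularReciprocal (f : ℍ[ℝ] → ℍ[ℝ]) : ℍ[ℝ] → ℍ[ℝ] :=
  fun q => (symmetrization f q)⁻¹ * regularConj f q

/-- The `*`-quotient `f^{-*} * g`, meaningful outside the zeros of `f^s`. -/
def starQuotient (f g : ℍ[ℝ] → ℍ[ℝ]) : ℍ[ℝ] → ℍ[ℝ] := starProd (regularReciprocal f) g

/-- The function `q ↦ (q - p)^{*n}`, for `n` a natural number. -/
def starPow (p : ℍ[ℝ]) : ℕ → ℍ[ℝ] → ℍ[ℝ]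
  | 0 => fun _ => 1
  | n + 1 => starProd (starPow p n) (fun q => q - p)

open Classical in
/-- The function `q ↦ (q - p)^{*n}`, for `n` an integer: for `n = -m < 0` it is the regular
reciprocal of `(q - p)^{*m}`. At `q = conj p`, where the formula for the latter reads `0 / 0`,
the value is that of its holomorphic extension along the slice through `p`, namely
`(conj p - p)^{-m}`. -/
def starZPow (p : ℍ[ℝ]) : ℤ → ℍ[ℝ] → ℍ[ℝ]
  | Int.ofNat n => starPow p n
  | Int.negSucc m => fun q =>
      if q = star p then ((star p - p) ^ (m + 1))⁻¹ else regularReciprocal (starPow p (m + 1)) q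

/-! ### Multiplicity of zeros -/

/-- The classical multiplicity `m_f(p)` of `p` as a zero of the regular function `f` on `Ω`: the
largest `n` with `f(q) = (q - p)^{*n} * h(q)` for some regular `h` on `Ω`
(`⊤` if there is no largest one). -/
def classicalMultiplicity (Ω : Set ℍ[ℝ]) (f : ℍ[ℝ] → ℍ[ℝ]) (p : ℍ[ℝ]) : ℕ∞ :=
  sSup {N : ℕ∞ | ∃ n : ℕ, N = n ∧
    ∃ h : ℍ[ℝ] → ℍ[ℝ], IsRegularOn Ω h ∧ ∀ q ∈ Ω, f q = starProd (starPow p n) h q}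

/-! ### Laurent expansions and singularities -/

/-- The quaternions `p` and `q` lie on the same complex line `ℝ + I ℝ`. -/
def OnSameLine (q p : ℍ[ℝ]) : Prop :=
  ∃ I ∈ imagUnits, q ∈ Set.range (slicePoint I) ∧ p ∈ Set.range (slicePoint I)

open Classical in
/-- The distance `σ`. -/
def sigmaDist (q p : ℍ[ℝ]) : ℝ :=
  if OnSameLine q p then ‖q - p‖
  else Real.sqrt ((q.re - p.re) ^ 2 + (‖q.im‖ + ‖p.im‖) ^ 2)

open Classical in
/-- The function `τ`. -/
def tauFun (q p : ℍ[ℝ]) : ℝ :=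
  if OnSameLine q p then ‖q - p‖
  else Real.sqrt ((q.re - p.re) ^ 2 + (‖q.im‖ - ‖p.im‖) ^ 2)

/-- The set `Σ(p, R₁, R₂) = {q : τ(q,p) > R₁, σ(q,p) < R₂}`. -/
def sigmaShell (p : ℍ[ℝ]) (R₁ R₂ : ℝ) : Set ℍ[ℝ] :=
  {q | R₁ < tauFun q p ∧ sigmaDist q p < R₂}

/-- The Laurent series `∑ (q - p)^{*n} a_n` converges to `f(q)` at all points `q` of
`Σ(p, 0, R)`. -/
def HasLaurentExpansion (f : ℍ[ℝ] → ℍ[ℝ]) (p : ℍ[ℝ]) (R : ℝ) (a : ℤ → ℍ[ℝ]) : Prop :=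
  ∀ q ∈ sigmaShell p 0 R, HasSum (fun n : ℤ => starZPow p n q * a n) (f q)

/-- The point `p` is a singularity for a function with domain `Ω`. -/
def IsSingularity (Ω : Set ℍ[ℝ]) (p : ℍ[ℝ]) : Prop :=
  ∃ R : ℝ, 0 < R ∧ sigmaShell p 0 R ⊆ Ω

/-- The point `p` is a singularity for the function `f` with domain `Ω`, and the coefficients of
the Laurent expansion of `f` at `p` satisfy `a_{-k} = 0` for all `k > m`. -/
def IsPoleOfOrderLE (Ω : Set ℍ[ℝ]) (f : ℍ[ℝ] → ℍ[ℝ]) (p : ℍ[ℝ]) (m : ℕ) : Prop :=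
  ∃ R : ℝ, 0 < R ∧ sigmaShell p 0 R ⊆ Ω ∧
    ∃ a : ℤ → ℍ[ℝ], HasLaurentExpansion f p R a ∧ ∀ k : ℕ, m < k → a (-(k : ℤ)) = 0

/-- The point `p` is a pole (possibly of order `0`) for the function `f` with domain `Ω`. -/
def IsPole (Ω : Set ℍ[ℝ]) (f : ℍ[ℝ] → ℍ[ℝ]) (p : ℍ[ℝ]) : Prop :=
  ∃ m : ℕ, IsPoleOfOrderLE Ω f p m

/-- The order `ord_f(p)` of a singularity `p` of the function `f` with domain `Ω`: the least `m`
such that `a_{-k} = 0` for all `k > m`, and `⊤` if there is none. -/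
def poleOrder (Ω : Set ℍ[ℝ]) (f : ℍ[ℝ] → ℍ[ℝ]) (p : ℍ[ℝ]) : ℕ∞ :=
  sInf {M : ℕ∞ | ∃ m : ℕ, M = m ∧ IsPoleOfOrderLE Ω f p m}

/-- The point `p` is a removable singularity for the function `f` with domain `Ω`: it is a
singularity and `f` extends to a neighborhood of `p` as a regular function. -/
def IsRemovable (Ω : Set ℍ[ℝ]) (f : ℍ[ℝ] → ℍ[ℝ]) (p : ℍ[ℝ]) : Prop :=
  IsSingularity Ω p ∧
    ∃ U : Set ℍ[ℝ], IsOpen U ∧ p ∈ U ∧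
      ∃ h : ℍ[ℝ] → ℍ[ℝ], IsRegularOn U h ∧ ∀ q ∈ U ∩ Ω, h q = f q

/-- The function `f` with domain `Ω'` is semiregular in `Ω`: `Ω' ⊆ Ω` is a symmetric slice domain,
`f` is regular in `Ω'`, and every point of `Ω \ Ω'` is a pole or a removable singularity of `f`. -/
structure IsSemiregularIn (Ω Ω' : Set ℍ[ℝ]) (f : ℍ[ℝ] → ℍ[ℝ]) : Prop where
  subset : Ω' ⊆ Ω
  isSymmetricSliceDomain : IsSymmetricSliceDomain Ω'
  isRegularOn : IsRegularOn Ω' f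
  singularities : ∀ p ∈ Ω \ Ω', IsPole Ω' f p ∨ IsRemovable Ω' f p

end SliceRegular

end

open scoped Quaternion
noncomputable section
namespace SliceRegular

/-! ### Algebra of slices -/

/-! A slice function is encoded by its stem function: a map `F` from the planar slice to `ℍ[ℂ]` with
`F(conj z)` the componentwise conjugate of `F(z)`. The value at `x + I y` is `F(z)` with `√-1`
replaced by `I`, standing to the left of the quaternionic basis. In this dictionary the `*`-product
is the pointwise product of `ℍ[ℂ]`, `f^c` is quaternionic conjugation, and `f^s` is the complex
scalar `N = normSq F` (`stemNorm`). On a symmetric slice domain, regularity is componentwise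
holomorphy of the stem (`holomorphicStemOn`, `eval_eq`, `isRegularOn_of_stem`). Hence `f^{-*} * g`
has stem `N⁻¹ F^c G`, and everything reduces to the zeros of one holomorphic function `N`.

If `N = (z - w)^k v` near `w` with `v(w) ≠ 0`, then `v⁻¹ F^c G` has a Taylor series at `w`. On the
slice through `p` the function `(q - p)^{*n}` is the ordinary power `(z - w)^n`
(`starZPow_slicePoint`), so shifting the index by `k` gives the Laurent series and bounds the order
by `k` (`isPoleOfOrderLE`). For nonreal `p` a small shell lies in a single slice. For real `p` it is
a punctured ball, and the coefficients must be shown not to depend on the slice.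

The number `k` is exactly the classical multiplicity of `f^s` at `p`
(`classicalMultiplicity_symmetrization`). It is finite: `N = |f|²` on the real axis, so `N ≡ 0`
would force `f ≡ 0`. Finally, the zeros of `N` do not disconnect a planar domain, and the slices of
the complement are joined along the real axis, so the complement is again a symmetric slice domain.
-/

theorem mem_imagUnits_iff {I : ℍ[ℝ]} :
    I ∈ imagUnits ↔ I.re = 0 ∧ I.imI ^ 2 + I.imJ ^ 2 + I.imK ^ 2 = 1 := by
  have key : I ∈ imagUnits ↔ I * I = -1 := by rw [imagUnits, Set.mem_ofPred_eq, sq]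
  rw [key]
  constructor
  · intro h
    have h0 := congrArg QuaternionAlgebra.re h
    have h1 := congrArg QuaternionAlgebra.imI h
    have h2 := congrArg QuaternionAlgebra.imJ h
    have h3 := congrArg QuaternionAlgebra.imK h
    simp at h0 h1 h2 h3
    have hre : I.re = 0 := by
      by_contra hne
      have e1 : I.imI = 0 := by
        have : I.re * (2 * I.imI) = 0 := by linarith
        simpa [hne] using this
      have e2 : I.imJ = 0 := by
        have : I.re * (2 * I.imJ) = 0 := by linarith
        simpa [hne] using this
      have e3 : I.imK = 0 := by
        have : I.re * (2 * I.imK) = 0 := by linarith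
        simpa [hne] using this
      rw [e1, e2, e3] at h0
      nlinarith [mul_self_nonneg I.re]
    refine ⟨hre, ?_⟩
    rw [hre] at h0
    linarith
  · rintro ⟨h0, h1⟩
    ext <;> simp [h0] <;> linarith

theorem imagUnits_mul_self {I : ℍ[ℝ]} (hI : I ∈ imagUnits) : I * I = -1 := by
  rw [← sq]; exact hI

theorem unitI_mem : unitI ∈ imagUnits := by simp [mem_imagUnits_iff]

theorem neg_mem_imagUnits {I : ℍ[ℝ]} (hI : I ∈ imagUnits) : -I ∈ imagUnits := by
  simpa [imagUnits] using hI

@[simp] theorem slicePoint_re (I : ℍ[ℝ]) (z : ℂ) :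
    (slicePoint I z).re = z.re + I.re * z.im := by simp [slicePoint]
@[simp] theorem slicePoint_imI (I : ℍ[ℝ]) (z : ℂ) :
    (slicePoint I z).imI = I.imI * z.im := by simp [slicePoint]
@[simp] theorem slicePoint_imJ (I : ℍ[ℝ]) (z : ℂ) :
    (slicePoint I z).imJ = I.imJ * z.im := by simp [slicePoint]
@[simp] theorem slicePoint_imK (I : ℍ[ℝ]) (z : ℂ) :
    (slicePoint I z).imK = I.imK * z.im := by simp [slicePoint]

theorem slicePoint_add (I : ℍ[ℝ]) (z w : ℂ) :
    slicePoint I (z + w) = slicePoint I z + slicePoint I w := by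
  ext <;> simp <;> ring

theorem slicePoint_sub (I : ℍ[ℝ]) (z w : ℂ) :
    slicePoint I (z - w) = slicePoint I z - slicePoint I w := by
  ext <;> simp <;> ring

theorem slicePoint_smul (I : ℍ[ℝ]) (r : ℝ) (z : ℂ) :
    slicePoint I (r • z) = r • slicePoint I z := by
  ext <;> simp <;> ring

theorem slicePoint_mul {I : ℍ[ℝ]} (hI : I ∈ imagUnits) (z w : ℂ) :
    slicePoint I (z * w) = slicePoint I z * slicePoint I w := by
  obtain ⟨h0, h1⟩ := mem_imagUnits_iff.1 hI
  ext <;> simp [h0]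
  · linear_combination (z.im * w.im) * h1
  all_goals ring

@[simp] theorem slicePoint_ofReal (I : ℍ[ℝ]) (r : ℝ) : slicePoint I (r : ℂ) = (r : ℍ[ℝ]) := by
  ext <;> simp

@[simp] theorem slicePoint_zero (I : ℍ[ℝ]) : slicePoint I 0 = 0 := by
  ext <;> simp

@[simp] theorem slicePoint_one (I : ℍ[ℝ]) : slicePoint I 1 = 1 := by
  ext <;> simp

@[simp] theorem slicePoint_I (I : ℍ[ℝ]) : slicePoint I Complex.I = I := by
  ext <;> simp

theorem slicePoint_star (I : ℍ[ℝ]) (z : ℂ) : slicePoint I (star z) = slicePoint (-I) z := by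
  ext <;> simp

theorem star_slicePoint {I : ℍ[ℝ]} (hI : I ∈ imagUnits) (z : ℂ) :
    star (slicePoint I z) = slicePoint I (star z) := by
  obtain ⟨h0, -⟩ := mem_imagUnits_iff.1 hI
  ext <;> simp [h0]

theorem norm_slicePoint {I : ℍ[ℝ]} (hI : I ∈ imagUnits) (z : ℂ) : ‖slicePoint I z‖ = ‖z‖ := by
  obtain ⟨h0, h1⟩ := mem_imagUnits_iff.1 hI
  rw [← sq_eq_sq₀ (norm_nonneg _) (norm_nonneg _), Complex.sq_norm, sq,
    ← Quaternion.normSq_eq_norm_mul_self, Quaternion.normSq_def', Complex.normSq_apply]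
  simp [h0]
  linear_combination z.im ^ 2 * h1

theorem slicePoint_injective {I : ℍ[ℝ]} (hI : I ∈ imagUnits) :
    Function.Injective (slicePoint I) := fun z w h => by
  rw [← sub_eq_zero, ← norm_eq_zero, ← norm_slicePoint hI, slicePoint_sub, h, sub_self, norm_zero]

/-- For an imaginary unit `I`, the map `x + i y ↦ x + I y` as a ring homomorphism. -/
def slicePointHom {I : ℍ[ℝ]} (hI : I ∈ imagUnits) : ℂ →+* ℍ[ℝ] where
  toFun := slicePoint I
  map_one' := slicePoint_one I
  map_mul' := slicePoint_mul hI
  map_zero' := slicePoint_zero I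
  map_add' := slicePoint_add I

theorem slicePoint_pow {I : ℍ[ℝ]} (hI : I ∈ imagUnits) (z : ℂ) (n : ℕ) :
    slicePoint I (z ^ n) = slicePoint I z ^ n := map_pow (slicePointHom hI) z n

theorem slicePoint_inv {I : ℍ[ℝ]} (hI : I ∈ imagUnits) (z : ℂ) :
    slicePoint I z⁻¹ = (slicePoint I z)⁻¹ := map_inv₀ (slicePointHom hI) z

/-- The map `x + i y ↦ x + I y` as a continuous real-linear map. -/
def slicePointL (I : ℍ[ℝ]) : ℂ →L[ℝ] ℍ[ℝ] :=
  LinearMap.toContinuousLinearMap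
    { toFun := slicePoint I
      map_add' := slicePoint_add I
      map_smul' := slicePoint_smul I }

@[simp] theorem slicePointL_apply (I : ℍ[ℝ]) (z : ℂ) : slicePointL I z = slicePoint I z := rfl

theorem norm_im_slicePoint {I : ℍ[ℝ]} (hI : I ∈ imagUnits) (z : ℂ) :
    ‖(slicePoint I z).im‖ = |z.im| := by
  obtain ⟨h0, h1⟩ := mem_imagUnits_iff.1 hI
  rw [← sq_eq_sq₀ (norm_nonneg _) (abs_nonneg _), sq_abs, sq,
    ← Quaternion.normSq_eq_norm_mul_self, Quaternion.normSq_def']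
  simp
  linear_combination z.im ^ 2 * h1

/-- Every quaternion lies on a slice, with nonnegative imaginary coordinate. -/
theorem exists_slicePoint_eq (q : ℍ[ℝ]) :
    ∃ I ∈ imagUnits, slicePoint I ⟨q.re, ‖q.im‖⟩ = q := by
  rcases eq_or_ne q.im 0 with h | h
  · refine ⟨unitI, unitI_mem, ?_⟩
    have := Quaternion.re_add_im q
    rw [h] at this
    simpa [slicePoint, h] using this
  · have hn : ‖q.im‖ ≠ 0 := norm_ne_zero_iff.2 h
    refine ⟨‖q.im‖⁻¹ • q.im, ?_, ?_⟩
    · have := Quaternion.normSq_eq_norm_mul_self q.im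
      rw [Quaternion.normSq_def'] at this
      rw [mem_imagUnits_iff]
      simp at this ⊢
      field_simp
      linarith
    · ext <;> simp <;> field_simp

theorem mem_slice {Ω : Set ℍ[ℝ]} {I : ℍ[ℝ]} {z : ℂ} : z ∈ slice Ω I ↔ slicePoint I z ∈ Ω := Iff.rfl

theorem IsAxiallySymmetric.slice_eq {Ω : Set ℍ[ℝ]} (h : IsAxiallySymmetric Ω) {I J : ℍ[ℝ]}
    (hI : I ∈ imagUnits) (hJ : J ∈ imagUnits) : slice Ω I = slice Ω J :=
  Set.ext fun z => ⟨fun hz => h I hI z hz J hJ, fun hz => h J hJ z hz I hI⟩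

theorem IsAxiallySymmetric.star_mem_slice {Ω : Set ℍ[ℝ]} (h : IsAxiallySymmetric Ω) {I : ℍ[ℝ]}
    (hI : I ∈ imagUnits) {z : ℂ} (hz : z ∈ slice Ω I) : star z ∈ slice Ω I := by
  rw [mem_slice, slicePoint_star]
  exact h I hI z hz _ (neg_mem_imagUnits hI)

/-! ### Stem functions -/

/-- The imaginary unit `k`. -/
def unitK : ℍ[ℝ] := ⟨0, 0, 0, 1⟩

@[simp] theorem unitK_re : unitK.re = 0 := rfl
@[simp] theorem unitK_imI : unitK.imI = 0 := rfl
@[simp] theorem unitK_imJ : unitK.imJ = 0 := rfl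
@[simp] theorem unitK_imK : unitK.imK = 1 := rfl

/-- The value `α + I β` of a slice function whose stem function takes the value `α + √-1 β`
in the complexified quaternions. -/
def evalStem (I : ℍ[ℝ]) (s : ℍ[ℂ]) : ℍ[ℝ] :=
  slicePoint I s.re + slicePoint I s.imI * unitI + slicePoint I s.imJ * unitJ
    + slicePoint I s.imK * unitK

/-- The componentwise complex conjugation of the complexified quaternions. -/
def conjStem (s : ℍ[ℂ]) : ℍ[ℂ] := ⟨star s.re, star s.imI, star s.imJ, star s.imK⟩

@[simp] theorem conjStem_re (s : ℍ[ℂ]) : (conjStem s).re = star s.re := rfl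
@[simp] theorem conjStem_imI (s : ℍ[ℂ]) : (conjStem s).imI = star s.imI := rfl
@[simp] theorem conjStem_imJ (s : ℍ[ℂ]) : (conjStem s).imJ = star s.imJ := rfl
@[simp] theorem conjStem_imK (s : ℍ[ℂ]) : (conjStem s).imK = star s.imK := rfl

/-- The stem function of `f`, computed from the splitting of `f` on the slice of `i`. -/
def stem (f : ℍ[ℝ] → ℍ[ℝ]) (z : ℂ) : ℍ[ℂ] :=
  ⟨(splitF f z + star (splitF f (star z))) / 2,
    -Complex.I * (splitF f z - star (splitF f (star z))) / 2,
    (splitG f z + star (splitG f (star z))) / 2,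
    -Complex.I * (splitG f z - star (splitG f (star z))) / 2⟩

@[simp] theorem stem_re (f : ℍ[ℝ] → ℍ[ℝ]) (z : ℂ) :
    (stem f z).re = (splitF f z + star (splitF f (star z))) / 2 := rfl
@[simp] theorem stem_imI (f : ℍ[ℝ] → ℍ[ℝ]) (z : ℂ) :
    (stem f z).imI = -Complex.I * (splitF f z - star (splitF f (star z))) / 2 := rfl
@[simp] theorem stem_imJ (f : ℍ[ℝ] → ℍ[ℝ]) (z : ℂ) :
    (stem f z).imJ = (splitG f z + star (splitG f (star z))) / 2 := rfl
@[simp] theorem stem_imK (f : ℍ[ℝ] → ℍ[ℝ]) (z : ℂ) :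
    (stem f z).imK = -Complex.I * (splitG f z - star (splitG f (star z))) / 2 := rfl

theorem splitF_eq (f : ℍ[ℝ] → ℍ[ℝ]) (z : ℂ) :
    splitF f z = (stem f z).re + Complex.I * (stem f z).imI := by
  simp only [stem_re, stem_imI]
  linear_combination (splitF f z - star (splitF f (star z))) / 2 * Complex.I_mul_I

theorem splitG_eq (f : ℍ[ℝ] → ℍ[ℝ]) (z : ℂ) :
    splitG f z = (stem f z).imJ + Complex.I * (stem f z).imK := by
  simp only [stem_imJ, stem_imK]
  linear_combination (splitG f z - star (splitG f (star z))) / 2 * Complex.I_mul_I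

theorem stem_star (f : ℍ[ℝ] → ℍ[ℝ]) (z : ℂ) : stem f (star z) = conjStem (stem f z) := by
  ext <;> simp <;> ring

theorem conjStem_mul (s t : ℍ[ℂ]) : conjStem (s * t) = conjStem s * conjStem t := by
  ext <;> simp

theorem stem_smul_mul (c : ℂ) (s t : ℍ[ℂ]) : c • s * t = c • (s * t) := by
  ext <;> simp <;> ring

theorem conjStem_smul (c : ℂ) (s : ℍ[ℂ]) : conjStem (c • s) = star c • conjStem s := by
  ext <;> simp

theorem conjStem_star (s : ℍ[ℂ]) : conjStem (star s) = star (conjStem s) := by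
  ext <;> simp

theorem normSq_conjStem (s : ℍ[ℂ]) :
    Quaternion.normSq (conjStem s) = star (Quaternion.normSq s) := by
  simp [Quaternion.normSq_def']

theorem evalStem_conjStem (I : ℍ[ℝ]) (s : ℍ[ℂ]) :
    evalStem I (conjStem s) = evalStem (-I) s := by
  simp only [evalStem, conjStem_re, conjStem_imI, conjStem_imJ, conjStem_imK, slicePoint_star]

theorem evalStem_smul {I : ℍ[ℝ]} (hI : I ∈ imagUnits) (c : ℂ) (s : ℍ[ℂ]) :
    evalStem I (c • s) = slicePoint I c * evalStem I s := by
  simp only [evalStem, Quaternion.re_smul, Quaternion.imI_smul, Quaternion.imJ_smul,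
    Quaternion.imK_smul, smul_eq_mul, slicePoint_mul hI, mul_add, mul_assoc]

@[simp] theorem evalStem_coe (I : ℍ[ℝ]) (c : ℂ) : evalStem I (c : ℍ[ℂ]) = slicePoint I c := by
  simp [evalStem]

@[simp] theorem evalStem_one (I : ℍ[ℝ]) : evalStem I 1 = 1 := by
  simp [evalStem]

theorem evalStem_unitI (s : ℍ[ℂ]) :
    evalStem unitI s = slicePoint unitI (s.re + Complex.I * s.imI)
      + slicePoint unitI (s.imJ + Complex.I * s.imK) * unitJ := by
  ext <;> simp [evalStem]

/-- The regular extension of the restriction to the slice of `i` of a slice function is that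
slice function. -/
theorem regularExt_slicePoint {φ : ℂ → ℍ[ℝ]} {s : ℂ → ℍ[ℂ]}
    (hφ : ∀ z, φ z = evalStem unitI (s z)) (hs : ∀ z, s (star z) = conjStem (s z))
    {I : ℍ[ℝ]} (hI : I ∈ imagUnits) (z : ℂ) :
    regularExt φ (slicePoint I z) = evalStem I (s z) := by
  have key : ∀ J ∈ imagUnits, ∀ w : ℂ,
      (1 / 2 : ℝ) • ((1 - J * unitI) * φ w + (1 + J * unitI) * φ (star w)) = evalStem J (s w) := by
    intro J hJ w
    rw [hφ, hφ, hs]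
    ext <;> simp [evalStem, (mem_imagUnits_iff.1 hJ).1] <;> ring
  -- At a real point the unit `‖q.im‖⁻¹ • q.im` degenerates to `0`. This is harmless: both values of
  -- `φ` coincide there, so the terms containing the unit cancel in `key`.
  rcases eq_or_ne z.im 0 with h0 | h0
  · have hz : star z = z := Complex.conj_eq_iff_im.2 h0
    have e1 : (⟨(slicePoint I z).re, ‖(slicePoint I z).im‖⟩ : ℂ) = z := by
      apply Complex.ext <;> simp [norm_im_slicePoint hI, h0]
    have e2 : (⟨(slicePoint I z).re, -‖(slicePoint I z).im‖⟩ : ℂ) = z := by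
      apply Complex.ext <;> simp [norm_im_slicePoint hI, h0]
    have e3 : (slicePoint I z).im = 0 := by
      rw [← norm_eq_zero, norm_im_slicePoint hI, h0, abs_zero]
    have := key I hI z
    rw [hz] at this
    rw [← this, regularExt, e1, e2, e3]
    simp only [smul_zero, zero_mul, sub_zero, add_zero, one_mul]
    congr 1
    noncomm_ring
  -- `regularExt` reads `q` in the coordinates with positive imaginary part. The lower half plane
  -- follows by rewriting `x + I y` as `x + (-I)(-y)`.
  · have main : ∀ J ∈ imagUnits, ∀ w : ℂ, 0 < w.im →
        regularExt φ (slicePoint J w) = evalStem J (s w) := by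
      intro J hJ w hw
      have e1 : (⟨(slicePoint J w).re, ‖(slicePoint J w).im‖⟩ : ℂ) = w := by
        apply Complex.ext <;> simp [norm_im_slicePoint hJ, (mem_imagUnits_iff.1 hJ).1, abs_of_pos hw]
      have e2 : (⟨(slicePoint J w).re, -‖(slicePoint J w).im‖⟩ : ℂ) = star w := by
        apply Complex.ext <;> simp [norm_im_slicePoint hJ, (mem_imagUnits_iff.1 hJ).1, abs_of_pos hw]
      have e3 : ‖(slicePoint J w).im‖⁻¹ • (slicePoint J w).im = J := by
        rw [norm_im_slicePoint hJ, abs_of_pos hw]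
        ext <;> simp [(mem_imagUnits_iff.1 hJ).1] <;> field_simp
      rw [← key J hJ w, regularExt, e1, e2, e3]
    rcases h0.lt_or_gt with h | h
    · have := main (-I) (neg_mem_imagUnits hI) (star z) (by simpa using h)
      rwa [← slicePoint_star, star_star, hs, evalStem_conjStem, neg_neg] at this
    · exact main I hI z h

/-- The stem is built from the values of `f` at `z` and `conj z` on the slice of `i` alone, so these
two values determine it; no regularity is involved. -/
theorem stem_eq_of_eval {f : ℍ[ℝ] → ℍ[ℝ]} {z : ℂ} {s : ℍ[ℂ]}
    (h : f (slicePoint unitI z) = evalStem unitI s)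
    (h' : f (slicePoint unitI (star z)) = evalStem unitI (conjStem s)) : stem f z = s := by
  rw [Complex.star_def] at h'
  ext <;> apply Complex.ext <;> simp [splitF, splitG, h, h', evalStem] <;> ring

/-- Writing the splitting as `F = s₀ + i s₁`, `G = s₂ + i s₃`, reflection in the real axis changes
the sign of `i` only, and the defining formula of the `*`-product becomes Hamilton's product in
`ℍ[ℂ]`. This is pure algebra, valid for arbitrary `f` and `g`. -/
theorem starProd_slicePoint (f g : ℍ[ℝ] → ℍ[ℝ]) {I : ℍ[ℝ]} (hI : I ∈ imagUnits) (z : ℂ) :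
    starProd f g (slicePoint I z) = evalStem I (stem f z * stem g z) := by
  rw [starProd]
  refine regularExt_slicePoint (s := fun w => stem f w * stem g w) (fun w => ?_) (fun w => ?_) hI z
  · rw [splitF_eq f w, splitG_eq f w, splitF_eq g w, splitG_eq g w, splitF_eq g (star w),
      splitG_eq g (star w), stem_star]
    generalize stem f w = s
    generalize stem g w = t
    rw [evalStem_unitI]
    congr 2
    · simp
      linear_combination (s.imI * t.imI + s.imK * t.imK) * Complex.I_mul_I
    · congr 1
      simp
      linear_combination (s.imI * t.imK - s.imK * t.imI) * Complex.I_mul_I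
  · rw [stem_star, stem_star, conjStem_mul]

theorem regularConj_slicePoint (f : ℍ[ℝ] → ℍ[ℝ]) {I : ℍ[ℝ]} (hI : I ∈ imagUnits) (z : ℂ) :
    regularConj f (slicePoint I z) = evalStem I (star (stem f z)) := by
  refine regularExt_slicePoint (s := fun w => star (stem f w)) (fun w => ?_) (fun w => ?_) hI z
  · rw [splitF_eq f (star w), splitG_eq f w, stem_star]
    generalize stem f w = s
    ext <;> simp [evalStem] <;> ring
  · rw [stem_star, conjStem_star]

theorem stem_starProd (f g : ℍ[ℝ] → ℍ[ℝ]) (z : ℂ) :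
    stem (starProd f g) z = stem f z * stem g z :=
  stem_eq_of_eval (starProd_slicePoint f g unitI_mem z) (by
    rw [starProd_slicePoint f g unitI_mem, stem_star, stem_star, conjStem_mul])

theorem stem_regularConj (f : ℍ[ℝ] → ℍ[ℝ]) (z : ℂ) :
    stem (regularConj f) z = star (stem f z) :=
  stem_eq_of_eval (regularConj_slicePoint f unitI_mem z) (by
    rw [regularConj_slicePoint f unitI_mem, stem_star, conjStem_star])

/-- The stem function of the symmetrization, a scalar function. -/
def stemNorm (f : ℍ[ℝ] → ℍ[ℝ]) (z : ℂ) : ℂ := Quaternion.normSq (stem f z)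

theorem stemNorm_star (f : ℍ[ℝ] → ℍ[ℝ]) (z : ℂ) : stemNorm f (star z) = star (stemNorm f z) := by
  rw [stemNorm, stem_star, normSq_conjStem, stemNorm]

theorem symmetrization_slicePoint (f : ℍ[ℝ] → ℍ[ℝ]) {I : ℍ[ℝ]} (hI : I ∈ imagUnits) (z : ℂ) :
    symmetrization f (slicePoint I z) = slicePoint I (stemNorm f z) := by
  rw [symmetrization, starProd_slicePoint _ _ hI, stem_regularConj, Quaternion.self_mul_star,
    evalStem_coe, stemNorm]

theorem regularReciprocal_slicePoint (f : ℍ[ℝ] → ℍ[ℝ]) {I : ℍ[ℝ]} (hI : I ∈ imagUnits) (z : ℂ) :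
    regularReciprocal f (slicePoint I z) = evalStem I ((stemNorm f z)⁻¹ • star (stem f z)) := by
  rw [regularReciprocal, symmetrization_slicePoint f hI, regularConj_slicePoint f hI,
    evalStem_smul hI, slicePoint_inv hI]

theorem stem_regularReciprocal (f : ℍ[ℝ] → ℍ[ℝ]) (z : ℂ) :
    stem (regularReciprocal f) z = (stemNorm f z)⁻¹ • star (stem f z) :=
  stem_eq_of_eval (regularReciprocal_slicePoint f unitI_mem z) (by
    rw [regularReciprocal_slicePoint f unitI_mem, stem_star, stemNorm_star, conjStem_smul,
      conjStem_star, star_inv₀])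

theorem starQuotient_slicePoint (f g : ℍ[ℝ] → ℍ[ℝ]) {I : ℍ[ℝ]} (hI : I ∈ imagUnits) (z : ℂ) :
    starQuotient f g (slicePoint I z)
      = evalStem I ((stemNorm f z)⁻¹ • (star (stem f z) * stem g z)) := by
  rw [starQuotient, starProd_slicePoint _ _ hI, stem_regularReciprocal, stem_smul_mul]

/-- A quaternion as a constant element of the complexified quaternions. -/
def complexify (p : ℍ[ℝ]) : ℍ[ℂ] := ⟨p.re, p.imI, p.imJ, p.imK⟩

@[simp] theorem complexify_re (p : ℍ[ℝ]) : (complexify p).re = p.re := rfl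
@[simp] theorem complexify_imI (p : ℍ[ℝ]) : (complexify p).imI = p.imI := rfl
@[simp] theorem complexify_imJ (p : ℍ[ℝ]) : (complexify p).imJ = p.imJ := rfl
@[simp] theorem complexify_imK (p : ℍ[ℝ]) : (complexify p).imK = p.imK := rfl

@[simp] theorem evalStem_complexify (I p : ℍ[ℝ]) : evalStem I (complexify p) = p := by
  ext <;> simp [evalStem]

theorem stem_ofReal (f : ℍ[ℝ] → ℍ[ℝ]) (r : ℝ) : stem f r = complexify (f r) := by
  apply stem_eq_of_eval
  · simp
  · rw [evalStem_conjStem]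
    simp

/-- On the slice of `p`, evaluation of stem functions commutes with left multiplication by `p`. -/
theorem evalStem_complexify_mul {I : ℍ[ℝ]} (hI : I ∈ imagUnits) (w : ℂ) (t : ℍ[ℂ]) :
    evalStem I (complexify (slicePoint I w) * t) = slicePoint I w * evalStem I t := by
  obtain ⟨h0, -⟩ := mem_imagUnits_iff.1 hI
  ext <;> simp [evalStem, h0] <;> ring

/-! ### Regular functions and holomorphic stem functions -/

/-- For fixed `w`, a functional on `ℍ` that turns left multiplication by `I` into multiplication
by the complex number `i`. -/
def sliceFunctional (I w : ℍ[ℝ]) : ℍ[ℝ] →L[ℝ] ℂ :=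
  LinearMap.toContinuousLinearMap
    { toFun := fun v => ⟨(v * w).re, -(I * v * w).re⟩
      map_add' := fun u v => by apply Complex.ext <;> simp [add_mul, mul_add]; ring
      map_smul' := fun r v => by apply Complex.ext <;> simp; ring }

theorem sliceFunctional_apply (I w v : ℍ[ℝ]) :
    sliceFunctional I w v = ⟨(v * w).re, -(I * v * w).re⟩ := rfl

theorem sliceFunctional_slicePoint_mul {I : ℍ[ℝ]} (hI : I ∈ imagUnits) (w : ℍ[ℝ]) (c : ℂ)
    (v : ℍ[ℝ]) : sliceFunctional I w (slicePoint I c * v) = c * sliceFunctional I w v := by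
  have h1 : slicePoint I c * v * w = c.re • (v * w) + c.im • (I * v * w) := by
    rw [slicePoint, ← Quaternion.coe_mul_eq_smul, ← Quaternion.coe_mul_eq_smul, add_mul, add_mul,
      ← Quaternion.coe_commutes]
    simp only [mul_assoc]
  have h2 : I * (slicePoint I c * v) * w = c.re • (I * v * w) - c.im • (v * w) := by
    rw [slicePoint, ← Quaternion.coe_mul_eq_smul, ← Quaternion.coe_mul_eq_smul, add_mul, mul_add,
      add_mul, ← mul_assoc I (c.re : ℍ[ℝ]), ← Quaternion.coe_commutes,
      ← mul_assoc I (I * _), ← mul_assoc I I, imagUnits_mul_self hI]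
    simp only [mul_assoc, neg_mul, one_mul, sub_eq_add_neg]
  rw [sliceFunctional_apply, sliceFunctional_apply, h1, h2]
  apply Complex.ext <;> simp <;> ring

/-- The choice `w = star v` makes the real part equal to `normSq v`. -/
theorem eq_zero_of_sliceFunctional {I v : ℍ[ℝ]} (h : ∀ w, sliceFunctional I w v = 0) : v = 0 := by
  have := congrArg Complex.re (h (star v))
  rw [sliceFunctional_apply] at this
  simpa [Quaternion.self_mul_star, Quaternion.normSq_eq_zero] using this

/-- Componentwise holomorphy of a stem function. -/
structure HolomorphicStemOn (S : ℂ → ℍ[ℂ]) (D : Set ℂ) : Prop where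
  re : DifferentiableOn ℂ (fun z => (S z).re) D
  imI : DifferentiableOn ℂ (fun z => (S z).imI) D
  imJ : DifferentiableOn ℂ (fun z => (S z).imJ) D
  imK : DifferentiableOn ℂ (fun z => (S z).imK) D

theorem HolomorphicStemOn.mono {S : ℂ → ℍ[ℂ]} {D E : Set ℂ} (h : HolomorphicStemOn S D)
    (hE : E ⊆ D) : HolomorphicStemOn S E :=
  ⟨h.re.mono hE, h.imI.mono hE, h.imJ.mono hE, h.imK.mono hE⟩

theorem HolomorphicStemOn.star {S : ℂ → ℍ[ℂ]} {D : Set ℂ} (h : HolomorphicStemOn S D) :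
    HolomorphicStemOn (fun z => star (S z)) D :=
  ⟨by simpa using h.re, by simpa using h.imI.neg, by simpa using h.imJ.neg,
    by simpa using h.imK.neg⟩

theorem HolomorphicStemOn.mul {S T : ℂ → ℍ[ℂ]} {D : Set ℂ} (h : HolomorphicStemOn S D)
    (k : HolomorphicStemOn T D) : HolomorphicStemOn (fun z => S z * T z) D := by
  obtain ⟨h0, h1, h2, h3⟩ := h
  obtain ⟨k0, k1, k2, k3⟩ := k
  constructor <;> simp only [Quaternion.re_mul, Quaternion.imI_mul, Quaternion.imJ_mul,
    Quaternion.imK_mul] <;> fun_prop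

theorem HolomorphicStemOn.smul {c : ℂ → ℂ} {S : ℂ → ℍ[ℂ]} {D : Set ℂ}
    (hc : DifferentiableOn ℂ c D) (h : HolomorphicStemOn S D) :
    HolomorphicStemOn (fun z => c z • S z) D := by
  obtain ⟨h0, h1, h2, h3⟩ := h
  constructor <;> simp only [Quaternion.re_smul, Quaternion.imI_smul, Quaternion.imJ_smul,
    Quaternion.imK_smul, smul_eq_mul] <;> fun_prop

theorem HolomorphicStemOn.normSq {S : ℂ → ℍ[ℂ]} {D : Set ℂ} (h : HolomorphicStemOn S D) :
    DifferentiableOn ℂ (fun z => Quaternion.normSq (S z)) D := by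
  obtain ⟨h0, h1, h2, h3⟩ := h
  simp only [Quaternion.normSq_def']
  fun_prop

theorem HolomorphicStemOn.sliceFunctional {S : ℂ → ℍ[ℂ]} {D : Set ℂ} (h : HolomorphicStemOn S D)
    {I : ℍ[ℝ]} (hI : I ∈ imagUnits) (w : ℍ[ℝ]) :
    DifferentiableOn ℂ (fun z => sliceFunctional I w (evalStem I (S z))) D := by
  obtain ⟨h0, h1, h2, h3⟩ := h
  have : (fun z => SliceRegular.sliceFunctional I w (evalStem I (S z))) = fun z =>
      (S z).re * SliceRegular.sliceFunctional I w 1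
        + (S z).imI * SliceRegular.sliceFunctional I w unitI
        + (S z).imJ * SliceRegular.sliceFunctional I w unitJ
        + (S z).imK * SliceRegular.sliceFunctional I w unitK := by
    funext z
    rw [evalStem, map_add, map_add, map_add, sliceFunctional_slicePoint_mul hI,
      sliceFunctional_slicePoint_mul hI, sliceFunctional_slicePoint_mul hI,
      ← sliceFunctional_slicePoint_mul hI w _ 1, mul_one]
  rw [this]
  fun_prop

/-- The functional carries left multiplication by `I` to multiplication by `i`, so the equation
`(∂_x + I ∂_y) f_I = 0` becomes the Cauchy–Riemann equation of a complex-valued function. -/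
theorem IsRegularOn.differentiableOn_sliceFunctional {Ω : Set ℍ[ℝ]} {f : ℍ[ℝ] → ℍ[ℝ]}
    (hf : IsRegularOn Ω f) {I : ℍ[ℝ]} (hI : I ∈ imagUnits) (ho : IsOpen (slice Ω I)) (w : ℍ[ℝ]) :
    DifferentiableOn ℂ (fun z => sliceFunctional I w (f (slicePoint I z))) (slice Ω I) := by
  intro z hz
  apply DifferentiableAt.differentiableWithinAt
  obtain ⟨hc, hcr⟩ := hf I hI
  have hd : DifferentiableAt ℝ (fun z : ℂ => f (slicePoint I z)) z :=
    (hc.contDiffAt (ho.mem_nhds hz)).differentiableAt one_ne_zero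
  have hcomp := (sliceFunctional I w).hasFDerivAt.comp z hd.hasFDerivAt
  rw [differentiableAt_complex_iff_differentiableAt_real]
  refine ⟨hcomp.differentiableAt, ?_⟩
  have e := hcr z hz
  rw [smul_eq_zero_iff_right (by norm_num)] at e
  have e' : fderiv ℝ (fun w : ℂ => f (slicePoint I w)) z 1
      = -(I * fderiv ℝ (fun w : ℂ => f (slicePoint I w)) z Complex.I) := eq_neg_of_add_eq_zero_left e
  have hF : fderiv ℝ (fun z => sliceFunctional I w (f (slicePoint I z))) z
      = (sliceFunctional I w).comp (fderiv ℝ (fun w : ℂ => f (slicePoint I w)) z) := hcomp.fderiv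
  rw [hF, ContinuousLinearMap.comp_apply, ContinuousLinearMap.comp_apply, e', map_neg]
  have hm := sliceFunctional_slicePoint_mul hI w Complex.I
    (fderiv ℝ (fun w : ℂ => f (slicePoint I w)) z Complex.I)
  rw [slicePoint_I] at hm
  rw [hm, smul_eq_mul, mul_neg, ← mul_assoc, Complex.I_mul_I, neg_one_mul, neg_neg]

theorem differentiableOn_star_comp_star {F : ℂ → ℂ} {D : Set ℂ} (ho : IsOpen D)
    (hD : ∀ z ∈ D, star z ∈ D) (hF : DifferentiableOn ℂ F D) :
    DifferentiableOn ℂ (fun z => star (F (star z))) D := fun z hz =>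
  by
  have h := (hF.differentiableAt (ho.mem_nhds (hD z hz))).star_star
  rw [star_star] at h
  exact h.differentiableWithinAt

/-- On each slice `f_I` is a sum of holomorphic functions into `ℝ + I ℝ` multiplied on the right by
constants, and right multiplication commutes with `∂_x + I ∂_y`. -/
theorem isRegularOn_of_stem {Ω : Set ℍ[ℝ]} {f : ℍ[ℝ] → ℍ[ℝ]} {S : ℂ → ℍ[ℂ]}
    (ho : ∀ I ∈ imagUnits, IsOpen (slice Ω I))
    (hS : ∀ I ∈ imagUnits, HolomorphicStemOn S (slice Ω I))
    (hf : ∀ I ∈ imagUnits, ∀ z ∈ slice Ω I, f (slicePoint I z) = evalStem I (S z)) :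
    IsRegularOn Ω f := by
  intro I hI
  have hev : ∀ s : ℍ[ℂ], evalStem I s = slicePointL I s.re + slicePointL I s.imI * unitI
      + slicePointL I s.imJ * unitJ + slicePointL I s.imK * unitK := fun s => rfl
  obtain ⟨h0, h1, h2, h3⟩ := hS I hI
  constructor
  · refine ContDiffOn.congr ?_ (hf I hI)
    simp only [hev]
    have c0 := (h0.contDiffOn (n := 1) (ho I hI)).restrict_scalars ℝ
    have c1 := (h1.contDiffOn (n := 1) (ho I hI)).restrict_scalars ℝ
    have c2 := (h2.contDiffOn (n := 1) (ho I hI)).restrict_scalars ℝ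
    have c3 := (h3.contDiffOn (n := 1) (ho I hI)).restrict_scalars ℝ
    fun_prop
  · intro z hz
    have hn := (ho I hI).mem_nhds hz
    have hL : ∀ {u : ℂ → ℂ}, DifferentiableOn ℂ u (slice Ω I) → ∀ v : ℍ[ℝ],
        HasFDerivAt (fun w => slicePointL I (u w) * v)
          (((ContinuousLinearMap.mul ℝ ℍ[ℝ]).flip v).comp ((slicePointL I).comp
            ((fderiv ℂ u z).restrictScalars ℝ))) z := fun hu v =>
      ((ContinuousLinearMap.mul ℝ ℍ[ℝ]).flip v).hasFDerivAt.comp z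
        ((slicePointL I).hasFDerivAt.comp z
          ((hu.differentiableAt hn).hasFDerivAt.restrictScalars ℝ))
    have hL0 := hL h0 1
    simp only [mul_one] at hL0
    have hsum := ((hL0.fun_add (hL h1 unitI)).fun_add (hL h2 unitJ)).fun_add (hL h3 unitK)
    have heq := hf I hI
    simp only [hev] at heq
    replace heq := Filter.eventuallyEq_of_mem hn heq
    have key : ∀ (L : ℂ →L[ℂ] ℂ) (v : ℍ[ℝ]),
        slicePoint I (L 1) * v + I * (slicePoint I (L Complex.I) * v) = 0 := by
      intro L v
      have : L Complex.I = Complex.I * L 1 := by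
        rw [← smul_eq_mul, ← map_smul, smul_eq_mul, mul_one]
      rw [this, slicePoint_mul hI, slicePoint_I, ← mul_assoc, ← mul_assoc, imagUnits_mul_self hI]
      simp
    rw [(hsum.congr_of_eventuallyEq heq).fderiv]
    have k0 := key (fderiv ℂ (fun z => (S z).re) z) 1
    have k1 := key (fderiv ℂ (fun z => (S z).imI) z) unitI
    have k2 := key (fderiv ℂ (fun z => (S z).imJ) z) unitJ
    have k3 := key (fderiv ℂ (fun z => (S z).imK) z) unitK
    rw [smul_eq_zero_iff_right (by norm_num)]
    simp only [add_apply, ContinuousLinearMap.comp_apply,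
      ContinuousLinearMap.flip_apply, ContinuousLinearMap.mul_apply',
      ContinuousLinearMap.coe_restrictScalars', slicePointL_apply, mul_add]
    have k := congrArg₂ (· + ·) (congrArg₂ (· + ·) k0 k1) (congrArg₂ (· + ·) k2 k3)
    simp only [add_zero] at k
    refine Eq.trans ?_ k
    abel

namespace IsSymmetricSliceDomain

variable {Ω : Set ℍ[ℝ]} {f : ℍ[ℝ] → ℍ[ℝ]}

theorem slice_eq (hΩ : IsSymmetricSliceDomain Ω) {I : ℍ[ℝ]} (hI : I ∈ imagUnits) :
    slice Ω I = slice Ω unitI := hΩ.symmetric.slice_eq hI unitI_mem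

theorem isOpen_slice_unitI (hΩ : IsSymmetricSliceDomain Ω) : IsOpen (slice Ω unitI) :=
  hΩ.isOpen_slice _ unitI_mem

theorem star_mem (hΩ : IsSymmetricSliceDomain Ω) {z : ℂ} (hz : z ∈ slice Ω unitI) :
    star z ∈ slice Ω unitI := hΩ.symmetric.star_mem_slice unitI_mem hz

theorem holomorphicStemOn (hΩ : IsSymmetricSliceDomain Ω) (hf : IsRegularOn Ω f) :
    HolomorphicStemOn (stem f) (slice Ω unitI) := by
  have ho := hΩ.isOpen_slice_unitI
  have hF : DifferentiableOn ℂ (splitF f) (slice Ω unitI) := by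
    refine (hf.differentiableOn_sliceFunctional unitI_mem ho 1).congr fun z _ => ?_
    rw [sliceFunctional_apply]
    apply Complex.ext <;> simp [splitF]
  have hG : DifferentiableOn ℂ (splitG f) (slice Ω unitI) := by
    refine (hf.differentiableOn_sliceFunctional unitI_mem ho (-unitJ)).congr fun z _ => ?_
    rw [sliceFunctional_apply]
    apply Complex.ext <;> simp [splitG]
  have hF' := differentiableOn_star_comp_star ho (fun z => hΩ.star_mem) hF
  have hG' := differentiableOn_star_comp_star ho (fun z => hΩ.star_mem) hG
  constructor <;> simp only [stem_re, stem_imI, stem_imJ, stem_imK] <;> fun_prop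

/-- Identity principle: a holomorphic function on a slice that vanishes on the real points of the
slice vanishes. -/
theorem eqOn_zero (hΩ : IsSymmetricSliceDomain Ω) {u : ℂ → ℂ}
    (hu : DifferentiableOn ℂ u (slice Ω unitI))
    (h0 : ∀ r : ℝ, (r : ℂ) ∈ slice Ω unitI → u r = 0) : ∀ z ∈ slice Ω unitI, u z = 0 := by
  obtain ⟨r, hr⟩ := hΩ.meets_real
  have hr' : (r : ℂ) ∈ slice Ω unitI := by rwa [mem_slice, slicePoint_ofReal]
  have ho := hΩ.isOpen_slice_unitI
  refine (hu.analyticOnNhd ho).eqOn_zero_of_preconnected_of_frequently_eq_zero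
    (hΩ.isConnected_slice _ unitI_mem).isPreconnected hr' ?_
  have ht : Filter.Tendsto (fun t : ℝ => (t : ℂ)) (nhdsWithin r {r}ᶜ) (nhdsWithin (r : ℂ) {(r : ℂ)}ᶜ) :=
    tendsto_nhdsWithin_of_tendsto_nhds_of_eventually_within _
      (Complex.continuous_ofReal.continuousAt.mono_left nhdsWithin_le_nhds)
      (by filter_upwards [self_mem_nhdsWithin] with t ht; simpa using ht)
  refine ht.frequently (Filter.Eventually.frequently ?_)
  have hm : ∀ᶠ t : ℝ in nhds r, (t : ℂ) ∈ slice Ω unitI :=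
    Complex.continuous_ofReal.continuousAt.eventually (ho.mem_nhds hr')
  filter_upwards [nhdsWithin_le_nhds hm] with t ht using h0 t ht

/-- The representation formula. -/
theorem eval_eq (hΩ : IsSymmetricSliceDomain Ω) (hf : IsRegularOn Ω f) {I : ℍ[ℝ]}
    (hI : I ∈ imagUnits) {z : ℂ} (hz : z ∈ slice Ω unitI) :
    f (slicePoint I z) = evalStem I (stem f z) := by
  rw [← sub_eq_zero]
  refine eq_zero_of_sliceFunctional (I := I) fun w => ?_
  rw [map_sub]
  -- Both sides are holomorphic after applying the functional and agree on the real axis, where the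
  -- stem is the constant quaternion `f r`.
  refine hΩ.eqOn_zero (u := fun z => sliceFunctional I w (f (slicePoint I z))
    - sliceFunctional I w (evalStem I (stem f z))) (DifferentiableOn.sub ?_ ?_) ?_ z hz
  · have := hf.differentiableOn_sliceFunctional hI (hΩ.isOpen_slice I hI) w
    rwa [hΩ.slice_eq hI] at this
  · exact (hΩ.holomorphicStemOn hf).sliceFunctional hI w
  · intro r hr
    rw [sub_eq_zero]
    rw [stem_ofReal, evalStem_complexify, slicePoint_ofReal]

end IsSymmetricSliceDomain

/-! ### The complement of the zero set of the symmetrization -/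

/-- Removing the zeros of a holomorphic function from a planar domain leaves a connected set: if
`A` and `B` separated it, the square of the function times the indicator of `A` would violate the
identity principle. -/
theorem isPreconnected_setOf_ne_zero {D : Set ℂ} (ho : IsOpen D) (hc : IsPreconnected D)
    {u : ℂ → ℂ} (hu : DifferentiableOn ℂ u D) : IsPreconnected {z | z ∈ D ∧ u z ≠ 0} := by
  classical
  intro A B hA hB hAB ⟨a, ⟨haD, hau⟩, haA⟩ ⟨b, ⟨hbD, hbu⟩, hbB⟩
  by_contra hempty
  have hdisj : ∀ z ∈ D, u z ≠ 0 → z ∈ A → z ∈ B → False := fun z hz huz h1 h2 =>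
    hempty ⟨z, ⟨hz, huz⟩, h1, h2⟩
  have hne : ∀ z ∈ D, u z ≠ 0 → ∀ᶠ w in nhds z, w ∈ D ∧ u w ≠ 0 := fun z hz huz =>
    Filter.Eventually.and (ho.mem_nhds hz)
      ((hu.differentiableAt (ho.mem_nhds hz)).continuousAt.eventually_ne huz)
  have hB0 : ∀ z ∈ D, u z ≠ 0 → z ∈ B →
      (fun w => if w ∈ A then u w ^ 2 else 0) =ᶠ[nhds z] fun _ => 0 := by
    intro z hz huz hzB
    filter_upwards [hne z hz huz, hB.mem_nhds hzB] with w hw hwB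
    rw [if_neg fun hwA => hdisj w hw.1 hw.2 hwA hwB]
  have hv : DifferentiableOn ℂ (fun w => if w ∈ A then u w ^ 2 else 0) D := by
    intro z hz
    apply DifferentiableAt.differentiableWithinAt
    have hd := hu.differentiableAt (ho.mem_nhds hz)
    -- This is where the square matters: at a zero of `u` it is `o(w - z)`, so the truncated
    -- function has derivative `0` there however `A` cuts the neighborhood.
    by_cases huz : u z = 0
    · have hO : (fun w => u w) =O[nhds z] fun w => w - z := by
        simpa [huz] using hd.hasFDerivAt.isBigO_sub
      have h2 : (fun w => u w ^ 2) =o[nhds z] fun w => w - z :=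
        Asymptotics.IsBigO.trans_isLittleO (by simpa [norm_pow] using (hO.pow 2).norm_right)
          (Asymptotics.isLittleO_pow_sub_sub z one_lt_two)
      refine HasDerivAt.differentiableAt (f' := 0) (hasDerivAt_iff_isLittleO.2 ?_)
      refine Asymptotics.IsBigO.trans_isLittleO (Asymptotics.isBigO_of_le _ fun w => ?_) h2
      simp only [huz, smul_zero, sub_zero]
      split_ifs <;> simp
    · rcases hAB ⟨hz, huz⟩ with h | h
      · refine (hd.pow 2).congr_of_eventuallyEq ?_
        filter_upwards [hA.mem_nhds h] with w hw
        simp [hw]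
      · exact (differentiableAt_const 0).congr_of_eventuallyEq (hB0 z hz huz h)
  have := (hv.analyticOnNhd ho).eqOn_zero_of_preconnected_of_eventuallyEq_zero hc hbD
    (hB0 b hbD hbu hbB) haD
  simp [haA, hau] at this

theorem mem_zeroSet_symmetrization {Ω : Set ℍ[ℝ]} (f : ℍ[ℝ] → ℍ[ℝ]) {I : ℍ[ℝ]}
    (hI : I ∈ imagUnits) {z : ℂ} : slicePoint I z ∈ zeroSet Ω (symmetrization f) ↔
      slicePoint I z ∈ Ω ∧ stemNorm f z = 0 := by
  rw [zeroSet, Set.mem_ofPred_eq, symmetrization_slicePoint f hI, ← slicePoint_zero I,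
    (slicePoint_injective hI).eq_iff]

namespace IsSymmetricSliceDomain

variable {Ω : Set ℍ[ℝ]} {f : ℍ[ℝ] → ℍ[ℝ]}

theorem slicePoint_mem (hΩ : IsSymmetricSliceDomain Ω) {I : ℍ[ℝ]} (hI : I ∈ imagUnits) {z : ℂ} :
    slicePoint I z ∈ Ω ↔ z ∈ slice Ω unitI := by
  rw [← hΩ.slice_eq hI, mem_slice]

theorem slice_diff_zeroSet (hΩ : IsSymmetricSliceDomain Ω) {I : ℍ[ℝ]} (hI : I ∈ imagUnits) :
    slice (Ω \ zeroSet Ω (symmetrization f)) I = {z | z ∈ slice Ω unitI ∧ stemNorm f z ≠ 0} := by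
  ext z
  rw [mem_slice, Set.mem_sdiff, mem_zeroSet_symmetrization f hI, hΩ.slicePoint_mem hI]
  simp only [Set.mem_ofPred_eq]
  tauto

theorem differentiableOn_stemNorm (hΩ : IsSymmetricSliceDomain Ω) (hf : IsRegularOn Ω f) :
    DifferentiableOn ℂ (stemNorm f) (slice Ω unitI) := (hΩ.holomorphicStemOn hf).normSq

/-- At real points the stem has real components, so `stemNorm f` equals `|f|²` there. Over `ℍ[ℂ]`
itself `normSq` has nontrivial zeros, hence the detour through the real axis and the identity
principle. -/
theorem exists_real_stemNorm_ne_zero (hΩ : IsSymmetricSliceDomain Ω) (hf : IsRegularOn Ω f)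
    (hf0 : ∃ q ∈ Ω, f q ≠ 0) : ∃ r : ℝ, (r : ℂ) ∈ slice Ω unitI ∧ stemNorm f r ≠ 0 := by
  by_contra! hcon
  obtain ⟨q, hq, hfq⟩ := hf0
  obtain ⟨I, hI, hIq⟩ := exists_slicePoint_eq q
  have hreal : ∀ r : ℝ, (r : ℂ) ∈ slice Ω unitI → stem f r = 0 := by
    intro r hr
    have h := hcon r hr
    rw [stemNorm, stem_ofReal, Quaternion.normSq_def'] at h
    have h' : Quaternion.normSq (f r) = 0 := by
      rw [Quaternion.normSq_def']
      simp only [complexify_re, complexify_imI, complexify_imJ, complexify_imK] at h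
      exact_mod_cast h
    rw [stem_ofReal, Quaternion.normSq_eq_zero.1 h']
    ext <;> simp
  have hS := hΩ.holomorphicStemOn hf
  have hz : (⟨q.re, ‖q.im‖⟩ : ℂ) ∈ slice Ω unitI := by
    rwa [← hΩ.slicePoint_mem hI, hIq]
  have hstem : stem f ⟨q.re, ‖q.im‖⟩ = 0 := by
    ext1
    · exact hΩ.eqOn_zero hS.re (fun r hr => by rw [hreal r hr]; rfl) _ hz
    · exact hΩ.eqOn_zero hS.imI (fun r hr => by rw [hreal r hr]; rfl) _ hz
    · exact hΩ.eqOn_zero hS.imJ (fun r hr => by rw [hreal r hr]; rfl) _ hz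
    · exact hΩ.eqOn_zero hS.imK (fun r hr => by rw [hreal r hr]; rfl) _ hz
  apply hfq
  rw [← hIq, hΩ.eval_eq hf hI hz, hstem]
  simp [evalStem]

theorem diff_zeroSet (hΩ : IsSymmetricSliceDomain Ω) (hf : IsRegularOn Ω f)
    (hf0 : ∃ q ∈ Ω, f q ≠ 0) :
    IsSymmetricSliceDomain (Ω \ zeroSet Ω (symmetrization f)) := by
  have ho := hΩ.isOpen_slice_unitI
  have hd := hΩ.differentiableOn_stemNorm hf
  obtain ⟨r, hr, hr0⟩ := hΩ.exists_real_stemNorm_ne_zero hf hf0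
  have hpre : IsPreconnected {z | z ∈ slice Ω unitI ∧ stemNorm f z ≠ 0} :=
    isPreconnected_setOf_ne_zero ho (hΩ.isConnected_slice _ unitI_mem).isPreconnected hd
  have hrmem : (r : ℍ[ℝ]) ∈ Ω \ zeroSet Ω (symmetrization f) := by
    rw [← slicePoint_ofReal unitI, ← mem_slice, hΩ.slice_diff_zeroSet unitI_mem]
    exact ⟨hr, hr0⟩
  -- This map folds `Ω` onto planar coordinates; openness in `ℍ` is pulled back along it.
  have hcont : Continuous fun q : ℍ[ℝ] => (⟨q.re, ‖q.im‖⟩ : ℂ) := by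
    have : (fun q : ℍ[ℝ] => (⟨q.re, ‖q.im‖⟩ : ℂ)) = fun q => (q.re : ℂ) + (‖q.im‖ : ℂ) * Complex.I := by
      funext q
      exact (Complex.mk_eq_add_mul_I _ _)
    rw [this]
    exact (Complex.continuous_ofReal.comp Quaternion.continuous_re).add
      ((Complex.continuous_ofReal.comp Quaternion.continuous_im.norm).mul continuous_const)
  refine ⟨?_, ⟨⟨r, hrmem⟩, ?_⟩, ⟨r, hrmem⟩, ?_, ?_, ?_⟩
  · have hmaps : Set.MapsTo (fun q : ℍ[ℝ] => (⟨q.re, ‖q.im‖⟩ : ℂ)) Ω (slice Ω unitI) := by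
      intro q hq
      obtain ⟨I, hI, hIq⟩ := exists_slicePoint_eq q
      rwa [← hΩ.slicePoint_mem hI, hIq]
    have h := (hd.continuousOn.comp hcont.continuousOn hmaps).isOpen_inter_preimage hΩ.isOpen
      (isOpen_compl_singleton (x := (0 : ℂ)))
    convert h using 1
    ext q
    obtain ⟨I, hI, hIq⟩ := exists_slicePoint_eq q
    rw [Set.mem_sdiff, Set.mem_inter_iff, ← hIq, mem_zeroSet_symmetrization f hI, hIq]
    simp only [Set.mem_preimage, Function.comp_apply, Set.mem_compl_iff, Set.mem_singleton_iff]
    tauto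
  -- Each point is joined to the common real point `r` inside its own slice.
  · refine isPreconnected_of_forall (r : ℍ[ℝ]) fun q hq => ?_
    obtain ⟨I, hI, hIq⟩ := exists_slicePoint_eq q
    refine ⟨slicePoint I '' slice (Ω \ zeroSet Ω (symmetrization f)) I, ?_, ?_, ?_, ?_⟩
    · exact Set.image_preimage_subset _ _
    · exact ⟨r, by rwa [mem_slice, slicePoint_ofReal], slicePoint_ofReal I r⟩
    · exact ⟨_, by rwa [mem_slice, hIq], hIq⟩
    · rw [hΩ.slice_diff_zeroSet hI]
      exact hpre.image _ (slicePointL I).continuous.continuousOn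
  · intro I hI
    rw [hΩ.slice_diff_zeroSet hI]
    exact hd.continuousOn.isOpen_inter_preimage ho (isOpen_compl_singleton (x := (0 : ℂ)))
  · intro I hI
    rw [hΩ.slice_diff_zeroSet hI]
    exact ⟨⟨r, hr, hr0⟩, hpre⟩
  · intro I hI z hz J hJ
    rw [← mem_slice, hΩ.slice_diff_zeroSet hI] at hz
    rwa [← mem_slice, hΩ.slice_diff_zeroSet hJ]

theorem isRegularOn_starQuotient (hΩ : IsSymmetricSliceDomain Ω) (hf : IsRegularOn Ω f)
    (hf0 : ∃ q ∈ Ω, f q ≠ 0) {g : ℍ[ℝ] → ℍ[ℝ]} (hg : IsRegularOn Ω g) :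
    IsRegularOn (Ω \ zeroSet Ω (symmetrization f)) (starQuotient f g) := by
  refine isRegularOn_of_stem (hΩ.diff_zeroSet hf hf0).isOpen_slice (fun I hI => ?_)
    fun I hI z _ => starQuotient_slicePoint f g hI z
  rw [hΩ.slice_diff_zeroSet hI]
  have hsub : {z | z ∈ slice Ω unitI ∧ stemNorm f z ≠ 0} ⊆ slice Ω unitI := fun z hz => hz.1
  exact HolomorphicStemOn.smul
    (((hΩ.differentiableOn_stemNorm hf).mono hsub).inv fun z hz => hz.2)
    (((hΩ.holomorphicStemOn hf).star.mul (hΩ.holomorphicStemOn hg)).mono hsub)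

end IsSymmetricSliceDomain

/-! ### Powers of `q - p` -/

theorem evalStem_add (I : ℍ[ℝ]) (s t : ℍ[ℂ]) :
    evalStem I (s + t) = evalStem I s + evalStem I t := by
  simp only [evalStem, Quaternion.re_add, Quaternion.imI_add, Quaternion.imJ_add,
    Quaternion.imK_add, slicePoint_add, add_mul]
  abel

theorem evalStem_sub (I : ℍ[ℝ]) (s t : ℍ[ℂ]) :
    evalStem I (s - t) = evalStem I s - evalStem I t := by
  rw [eq_sub_iff_add_eq, ← evalStem_add, sub_add_cancel]

theorem conjStem_coe_sub_complexify (p : ℍ[ℝ]) (z : ℂ) :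
    conjStem ((z : ℍ[ℂ]) - complexify p) = ((star z : ℂ) : ℍ[ℂ]) - complexify p := by
  ext <;> simp

theorem stem_sub_const (p : ℍ[ℝ]) (z : ℂ) :
    stem (fun q => q - p) z = (z : ℍ[ℂ]) - complexify p := by
  apply stem_eq_of_eval
  · simp [evalStem_sub]
  · rw [conjStem_coe_sub_complexify]
    simp [evalStem_sub]

theorem stem_starPow (p : ℍ[ℝ]) (n : ℕ) (z : ℂ) :
    stem (starPow p n) z = ((z : ℍ[ℂ]) - complexify p) ^ n := by
  induction n with
  | zero =>
    rw [pow_zero]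
    have h1 : conjStem 1 = 1 := by ext <;> simp
    exact stem_eq_of_eval (by simp [starPow]) (by simp [starPow, h1])
  | succ n ih => rw [starPow, stem_starProd, ih, stem_sub_const, pow_succ]

theorem starPow_slicePoint (p : ℍ[ℝ]) (n : ℕ) {I : ℍ[ℝ]} (hI : I ∈ imagUnits) (z : ℂ) :
    starPow p n (slicePoint I z) = evalStem I (((z : ℍ[ℂ]) - complexify p) ^ n) := by
  cases n with
  | zero => simp [starPow]
  | succ n => rw [starPow, starProd_slicePoint _ _ hI, stem_starPow, stem_sub_const, pow_succ]

theorem coe_mul_eq_stem_smul (c : ℂ) (s : ℍ[ℂ]) : (c : ℍ[ℂ]) * s = c • s := by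
  ext <;> simp

/-- On the slice of `p`, the powers of `z - p` act by the corresponding powers on the slice. -/
theorem evalStem_sub_pow_mul {I : ℍ[ℝ]} (hI : I ∈ imagUnits) (w z : ℂ) (n : ℕ) (t : ℍ[ℂ]) :
    evalStem I (((z : ℍ[ℂ]) - complexify (slicePoint I w)) ^ n * t)
      = slicePoint I ((z - w) ^ n) * evalStem I t := by
  induction n generalizing t with
  | zero => simp
  | succ n ih =>
    rw [pow_succ, mul_assoc, ih, sub_mul, evalStem_sub, evalStem_complexify_mul hI,
      coe_mul_eq_stem_smul, evalStem_smul hI, ← sub_mul, ← slicePoint_sub, ← mul_assoc,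
      ← slicePoint_mul hI, pow_succ]

theorem star_stem_mul (s t : ℍ[ℂ]) : star (s * t) = star t * star s := by
  ext <;> simp

theorem star_stem_pow (s : ℍ[ℂ]) (n : ℕ) : star (s ^ n) = star s ^ n := by
  induction n with
  | zero => ext <;> simp
  | succ n ih => rw [pow_succ, star_stem_mul, ih, pow_succ']

theorem star_coe_sub_complexify {I : ℍ[ℝ]} (hI : I ∈ imagUnits) (w z : ℂ) :
    star ((z : ℍ[ℂ]) - complexify (slicePoint I w))
      = (z : ℍ[ℂ]) - complexify (slicePoint I (star w)) := by
  ext <;> simp [(mem_imagUnits_iff.1 hI).1]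

theorem normSq_coe_sub_complexify {I : ℍ[ℝ]} (hI : I ∈ imagUnits) (w z : ℂ) :
    Quaternion.normSq ((z : ℍ[ℂ]) - complexify (slicePoint I w)) = (z - w) * (z - star w) := by
  obtain ⟨h0, h1⟩ := mem_imagUnits_iff.1 hI
  have h1' : (I.imI : ℂ) ^ 2 + (I.imJ : ℂ) ^ 2 + (I.imK : ℂ) ^ 2 = 1 := by exact_mod_cast h1
  have hs : star w = w.re - w.im * Complex.I := by
    apply Complex.ext <;> simp
  have hw : w = w.re + w.im * Complex.I := (Complex.re_add_im w).symm
  rw [hs, Quaternion.normSq_def']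
  simp [h0]
  linear_combination (w.im : ℂ) ^ 2 * h1' + (w.im : ℂ) ^ 2 * Complex.I_mul_I
    + (z - w.re + w.im * Complex.I) * hw

theorem starZPow_slicePoint {I : ℍ[ℝ]} (hI : I ∈ imagUnits) (w z : ℂ) (m : ℤ) :
    starZPow (slicePoint I w) m (slicePoint I z) = slicePoint I ((z - w) ^ m) := by
  rcases m with n | m
  · rw [starZPow, starPow_slicePoint _ _ hI, Int.ofNat_eq_natCast, zpow_natCast]
    simpa using evalStem_sub_pow_mul hI w z n 1
  · simp only [starZPow]
    rw [star_slicePoint hI, (slicePoint_injective hI).eq_iff, zpow_negSucc,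
      slicePoint_inv hI, slicePoint_pow hI, slicePoint_sub]
    -- At `conj p` the value is the prescribed one; elsewhere the factor `(z - conj w)^(m+1)`
    -- cancels between the conjugate and the symmetrization.
    split_ifs with h
    · rw [h]
    · rw [regularReciprocal_slicePoint _ hI, stemNorm, stem_starPow, map_pow,
        normSq_coe_sub_complexify hI, evalStem_smul hI, star_stem_pow, star_coe_sub_complexify hI]
      have := evalStem_sub_pow_mul hI (star w) z (m + 1) 1
      rw [mul_one, evalStem_one, mul_one] at this
      rw [this, ← slicePoint_mul hI, ← slicePoint_sub, ← slicePoint_pow hI, ← slicePoint_inv hI]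
      congr 1
      have hz : z - star w ≠ 0 := sub_ne_zero.2 h
      rw [mul_pow, mul_inv, mul_assoc, inv_mul_cancel₀ (pow_ne_zero _ hz), mul_one]

/-! ### Small shells around a point -/

/-- A real center shares a line with every quaternion, so the shell is a punctured Euclidean ball.
-/
theorem exists_of_mem_sigmaShell_real {x R : ℝ} {q : ℍ[ℝ]}
    (hq : q ∈ sigmaShell (x : ℍ[ℝ]) 0 R) :
    ∃ J ∈ imagUnits, ∃ z : ℂ, q = slicePoint J z ∧ z ≠ x ∧ ‖z - x‖ < R := by
  obtain ⟨J, hJ, hJq⟩ := exists_slicePoint_eq q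
  have hline : OnSameLine q x :=
    ⟨J, hJ, ⟨_, hJq⟩, ⟨x, slicePoint_ofReal J x⟩⟩
  obtain ⟨h1, h2⟩ := hq
  rw [tauFun, if_pos hline] at h1
  rw [sigmaDist, if_pos hline] at h2
  have hn : ‖q - x‖ = ‖(⟨q.re, ‖q.im‖⟩ : ℂ) - x‖ := by
    rw [← norm_slicePoint hJ, slicePoint_sub, hJq, slicePoint_ofReal]
  rw [hn] at h1 h2
  exact ⟨J, hJ, _, hJq.symm, sub_ne_zero.1 (norm_pos_iff.1 h1), h2⟩

/-- Off the slice of the center, `σ` is at least `|w.im|`, so a shell of radius at most `|w.im|`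
stays in that slice. -/
theorem exists_of_mem_sigmaShell {I : ℍ[ℝ]} (hI : I ∈ imagUnits) {w : ℂ} (hw : w.im ≠ 0) {R : ℝ}
    (hR : R ≤ |w.im|) {q : ℍ[ℝ]} (hq : q ∈ sigmaShell (slicePoint I w) 0 R) :
    ∃ z : ℂ, q = slicePoint I z ∧ z ≠ w ∧ ‖z - w‖ < R := by
  obtain ⟨h1, h2⟩ := hq
  by_cases hline : OnSameLine q (slicePoint I w)
  · rw [tauFun, if_pos hline] at h1
    rw [sigmaDist, if_pos hline] at h2
    obtain ⟨J, hJ, ⟨z, hz⟩, ⟨v, hv⟩⟩ := hline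
    -- A nonreal point lies on only one complex line: comparing imaginary parts makes `J` a multiple
    -- of `I`.
    have hIJ : ∃ z', q = slicePoint I z' := by
      have him : w.im • I = v.im • J := by
        ext
        · simp [(mem_imagUnits_iff.1 hI).1, (mem_imagUnits_iff.1 hJ).1]
        · simpa [mul_comm] using (congrArg QuaternionAlgebra.imI hv).symm
        · simpa [mul_comm] using (congrArg QuaternionAlgebra.imJ hv).symm
        · simpa [mul_comm] using (congrArg QuaternionAlgebra.imK hv).symm
      have hvim : v.im ≠ 0 := by
        intro h0
        rw [h0, zero_smul, smul_eq_zero] at him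
        have : I * I = -1 := imagUnits_mul_self hI
        rcases him with h | h
        · exact hw h
        · rw [h] at this
          simp at this
      have hJ' : J = (v.im⁻¹ * w.im) • I := by
        rw [mul_smul, him, smul_smul, inv_mul_cancel₀ hvim, one_smul]
      refine ⟨⟨z.re, v.im⁻¹ * w.im * z.im⟩, ?_⟩
      rw [← hz]
      nth_rewrite 1 [hJ']
      ext <;> simp <;> ring
    obtain ⟨z', rfl⟩ := hIJ
    rw [← slicePoint_sub, norm_slicePoint hI] at h1 h2
    exact ⟨z', rfl, sub_ne_zero.1 (norm_pos_iff.1 h1), h2⟩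
  · rw [sigmaDist, if_neg hline, norm_im_slicePoint hI] at h2
    have : |w.im| ≤ Real.sqrt ((q.re - (slicePoint I w).re) ^ 2 + (‖q.im‖ + |w.im|) ^ 2) := by
      apply Real.le_sqrt_of_sq_le
      nlinarith [sq_nonneg (q.re - (slicePoint I w).re), norm_nonneg q.im, abs_nonneg w.im,
        mul_nonneg (norm_nonneg q.im) (abs_nonneg w.im)]
    linarith

/-! ### Expansions in power series and Laurent series -/

/-- The Taylor coefficients live in `ℍ[ℂ]` and serve all slices; only their evaluations depend on
`I`. -/
theorem exists_hasSum_evalStem {S : ℂ → ℍ[ℂ]} {c : ℂ} {r : ℝ}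
    (hS : HolomorphicStemOn S (Metric.ball c r)) :
    ∃ C : ℕ → ℍ[ℂ], ∀ I ∈ imagUnits, ∀ z ∈ Metric.ball c r,
      HasSum (fun n => slicePoint I ((z - c) ^ n) * evalStem I (C n)) (evalStem I (S z)) := by
  have key : ∀ u : ℂ → ℂ, DifferentiableOn ℂ u (Metric.ball c r) → ∃ b : ℕ → ℂ,
      ∀ z ∈ Metric.ball c r, HasSum (fun n => (z - c) ^ n * b n) (u z) := by
    intro u hu
    refine ⟨fun n => ((n.factorial : ℂ))⁻¹ * iteratedDeriv n u c, fun z hz => ?_⟩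
    convert! Complex.hasSum_taylorSeries_on_ball hu hz using 2
    simp only [smul_eq_mul]
    ring
  obtain ⟨b0, h0⟩ := key _ hS.re
  obtain ⟨b1, h1⟩ := key _ hS.imI
  obtain ⟨b2, h2⟩ := key _ hS.imJ
  obtain ⟨b3, h3⟩ := key _ hS.imK
  refine ⟨fun n => ⟨b0 n, b1 n, b2 n, b3 n⟩, fun I hI z hz => ?_⟩
  have hmap : ∀ {b : ℕ → ℂ} {s : ℂ}, HasSum (fun n => (z - c) ^ n * b n) s →
      HasSum (fun n => slicePoint I ((z - c) ^ n) * slicePoint I (b n)) (slicePoint I s) := by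
    intro b s h
    simpa only [slicePointL_apply, slicePoint_mul hI] using (slicePointL I).hasSum h
  have := (((hmap (h0 z hz)).add ((hmap (h1 z hz)).mul_right unitI)).add
    ((hmap (h2 z hz)).mul_right unitJ)).add ((hmap (h3 z hz)).mul_right unitK)
  convert! this using 2
  simp only [evalStem, mul_add, mul_assoc]

/-- Averaging the expansions for `(I, z)` and `(-I, conj z)`, which represent the same point,
replaces each coefficient by its componentwise real part, a quaternion that no longer depends on
`I`. -/
theorem exists_hasSum_evalStem_real {S : ℂ → ℍ[ℂ]} {x r : ℝ}
    (hS : HolomorphicStemOn S (Metric.ball (x : ℂ) r))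
    (hsymm : ∀ z ∈ Metric.ball (x : ℂ) r, z ≠ x → S (star z) = conjStem (S z)) :
    ∃ a : ℕ → ℍ[ℝ], ∀ I ∈ imagUnits, ∀ z ∈ Metric.ball (x : ℂ) r, z ≠ x →
      HasSum (fun n => slicePoint I ((z - x) ^ n) * a n) (evalStem I (S z)) := by
  obtain ⟨C, hC⟩ := exists_hasSum_evalStem hS
  refine ⟨fun n => ⟨(C n).re.re, (C n).imI.re, (C n).imJ.re, (C n).imK.re⟩, fun I hI z hz hzx => ?_⟩
  have hz' : star z ∈ Metric.ball (x : ℂ) r := by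
    rw [Metric.mem_ball, Complex.dist_eq] at hz ⊢
    rwa [Complex.star_def, ← Complex.conj_ofReal x, ← map_sub, Complex.norm_conj]
  have h1 := hC I hI z hz
  have h2 := hC (-I) (neg_mem_imagUnits hI) (star z) hz'
  rw [hsymm z hz hzx, evalStem_conjStem, neg_neg] at h2
  have h3 := (h1.add h2).const_smul (1 / 2 : ℝ)
  convert! h3 using 2 with n
  · have e : (star z - (x : ℂ)) ^ n = star ((z - x) ^ n) := by
      simp
    rw [e, slicePoint_star, neg_neg, ← mul_add, ← mul_smul_comm]
    congr 1
    ext <;> simp [evalStem] <;> ring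
  · rw [← two_smul ℝ (evalStem I (S z)), smul_smul]
    norm_num

/-- The coefficients of a power series, shifted by `k` to the left. -/
def shiftCoeff (k : ℕ) (b : ℕ → ℍ[ℝ]) (m : ℤ) : ℍ[ℝ] :=
  if 0 ≤ m + k then b (m + k).toNat else 0

theorem shiftCoeff_neg {k m : ℕ} (h : k < m) (b : ℕ → ℍ[ℝ]) : shiftCoeff k b (-(m : ℤ)) = 0 :=
  if_neg (by omega)

/-- Shifting the index of a power series by `k` turns it into a Laurent series. -/
theorem hasSum_laurent {I : ℍ[ℝ]} (hI : I ∈ imagUnits) {w z : ℂ} (hz : z ≠ w) (k : ℕ)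
    {b : ℕ → ℍ[ℝ]} {s : ℍ[ℂ]} {v : ℂ}
    (hs : HasSum (fun n => slicePoint I ((z - w) ^ n) * b n) (evalStem I (v⁻¹ • s))) :
    HasSum (fun m : ℤ => starZPow (slicePoint I w) m (slicePoint I z) *
        shiftCoeff k b m)
      (evalStem I (((z - w) ^ k * v)⁻¹ • s)) := by
  have hzw : z - w ≠ 0 := sub_ne_zero.2 hz
  -- The Laurent coefficients below `-k` vanish, so the sum over `ℤ` is the power series reindexed
  -- by `m = n - k`.
  have hinj : Function.Injective fun n : ℕ => (n : ℤ) - k := fun a b h => by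
    simpa using h
  rw [← hinj.hasSum_iff]
  · convert! hs.mul_left (slicePoint I ((z - w) ^ k)⁻¹) using 2 with n
    · simp only [Function.comp_apply]
      rw [starZPow_slicePoint hI, zpow_sub₀ hzw, zpow_natCast, zpow_natCast, div_eq_inv_mul,
        slicePoint_mul hI, mul_assoc]
      simp [shiftCoeff]
    · rw [evalStem_smul hI, evalStem_smul hI, mul_inv, slicePoint_mul hI, mul_assoc]
  · intro m hm
    rw [shiftCoeff, if_neg, mul_zero]
    intro h
    exact hm ⟨(m + k).toNat, by simp [Int.toNat_of_nonneg h]⟩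

namespace IsSymmetricSliceDomain

variable {Ω : Set ℍ[ℝ]} {f g : ℍ[ℝ] → ℍ[ℝ]}

theorem analyticAt_stemNorm (hΩ : IsSymmetricSliceDomain Ω) (hf : IsRegularOn Ω f) {w : ℂ}
    (hw : w ∈ slice Ω unitI) : AnalyticAt ℂ (stemNorm f) w :=
  (hΩ.differentiableOn_stemNorm hf).analyticOnNhd hΩ.isOpen_slice_unitI w hw

theorem isPoleOfOrderLE (hΩ : IsSymmetricSliceDomain Ω) (hf : IsRegularOn Ω f)
    (hg : IsRegularOn Ω g) {I : ℍ[ℝ]} (hI : I ∈ imagUnits) {w : ℂ} (hw : w ∈ slice Ω unitI)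
    {k : ℕ} (hk : analyticOrderAt (stemNorm f) w = k) :
    IsPoleOfOrderLE (Ω \ zeroSet Ω (symmetrization f)) (starQuotient f g) (slicePoint I w) k := by
  obtain ⟨v, hv, hv0, heq⟩ := (hΩ.analyticAt_stemNorm hf hw).analyticOrderAt_eq_natCast.1 hk
  have ho := hΩ.isOpen_slice_unitI
  obtain ⟨r, hr, hball⟩ := Metric.eventually_nhds_iff_ball.1
    (((Filter.Eventually.and (ho.mem_nhds hw) heq).and (hv.continuousAt.eventually_ne hv0)).and
      hv.eventually_analyticAt)
  -- The bound by `|w.im|` confines the shell of a nonreal center to its slice.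
  obtain ⟨R, hR, hRr, hRw⟩ : ∃ R, 0 < R ∧ R ≤ r ∧ (w.im ≠ 0 → R ≤ |w.im|) := by
    by_cases h : w.im = 0
    · exact ⟨r, hr, le_rfl, fun h' => absurd h h'⟩
    · exact ⟨min r |w.im|, lt_min hr (abs_pos.2 h), min_le_left _ _, fun _ => min_le_right _ _⟩
  replace hball := fun z (hz : z ∈ Metric.ball w R) => hball z (Metric.ball_subset_ball hRr hz)
  have hsub : Metric.ball w R ⊆ slice Ω unitI := fun z hz => (hball z hz).1.1.1
  have hφ : ∀ z ∈ Metric.ball w R, stemNorm f z = (z - w) ^ k * v z := fun z hz =>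
    (hball z hz).1.1.2
  have hφ0 : ∀ z ∈ Metric.ball w R, z ≠ w → stemNorm f z ≠ 0 := fun z hz hzw => by
    rw [hφ z hz]
    exact mul_ne_zero (pow_ne_zero _ (sub_ne_zero.2 hzw)) (hball z hz).1.2
  have hS : HolomorphicStemOn (fun z => (v z)⁻¹ • (star (stem f z) * stem g z))
      (Metric.ball w R) :=
    HolomorphicStemOn.smul
      (DifferentiableOn.inv
        (fun z hz => (hball z hz).2.differentiableAt.differentiableWithinAt)
        fun z hz => (hball z hz).1.2)
      (((hΩ.holomorphicStemOn hf).star.mul (hΩ.holomorphicStemOn hg)).mono hsub)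
  have hmem : ∀ J ∈ imagUnits, ∀ z ∈ Metric.ball w R, z ≠ w →
      slicePoint J z ∈ Ω \ zeroSet Ω (symmetrization f) := fun J hJ z hz hzw => by
    rw [← mem_slice, hΩ.slice_diff_zeroSet hJ]
    exact ⟨hsub hz, hφ0 z hz hzw⟩
  by_cases him : w.im = 0
  · obtain ⟨x, rfl⟩ : ∃ x : ℝ, w = x := ⟨w.re, Complex.ext rfl (by simpa using him)⟩
    -- The symmetry of `v` is inherited from `stemNorm f` by cancelling `(z - x)^k`, hence only away
    -- from `x`.
    obtain ⟨b, hb⟩ := exists_hasSum_evalStem_real hS (fun z hz hzx => by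
      have hz' : star z ∈ Metric.ball (x : ℂ) R := by
        rw [Metric.mem_ball, Complex.dist_eq] at hz ⊢
        rwa [Complex.star_def, ← Complex.conj_ofReal x, ← map_sub, Complex.norm_conj]
      have hvs : v (star z) = star (v z) := by
        have h1 := stemNorm_star f z
        rw [hφ z hz, hφ _ hz', star_mul', star_pow, star_sub, Complex.star_def,
          Complex.conj_ofReal] at h1
        refine mul_left_cancel₀ (pow_ne_zero _ ?_) h1
        rw [← Complex.conj_ofReal x, ← map_sub]
        exact (map_ne_zero _).2 (sub_ne_zero.2 hzx)
      rw [hvs, stem_star, stem_star, conjStem_smul, conjStem_mul, conjStem_star, star_inv₀])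
    refine ⟨R, hR, ?_, shiftCoeff k b, ?_, fun m hm => shiftCoeff_neg hm b⟩
    · intro q hq
      rw [slicePoint_ofReal] at hq
      obtain ⟨J, hJ, z, rfl, hzx, hzR⟩ := exists_of_mem_sigmaShell_real hq
      exact hmem J hJ z (by rwa [Metric.mem_ball, Complex.dist_eq]) hzx
    · intro q hq
      rw [slicePoint_ofReal] at hq
      obtain ⟨J, hJ, z, rfl, hzx, hzR⟩ := exists_of_mem_sigmaShell_real hq
      have hz : z ∈ Metric.ball (x : ℂ) R := by rwa [Metric.mem_ball, Complex.dist_eq]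
      rw [starQuotient_slicePoint f g hJ, hφ z hz, slicePoint_ofReal, ← slicePoint_ofReal J]
      exact hasSum_laurent hJ hzx k (hb J hJ z hz hzx)
  · obtain ⟨C, hC⟩ := exists_hasSum_evalStem hS
    refine ⟨R, hR, ?_, shiftCoeff k fun n => evalStem I (C n), ?_,
      fun m hm => shiftCoeff_neg hm _⟩
    · intro q hq
      obtain ⟨z, rfl, hzw, hzR⟩ := exists_of_mem_sigmaShell hI him (hRw him) hq
      exact hmem I hI z (by rwa [Metric.mem_ball, Complex.dist_eq]) hzw
    · intro q hq
      obtain ⟨z, rfl, hzw, hzR⟩ := exists_of_mem_sigmaShell hI him (hRw him) hq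
      have hz : z ∈ Metric.ball w R := by rwa [Metric.mem_ball, Complex.dist_eq]
      rw [starQuotient_slicePoint f g hI, hφ z hz]
      exact hasSum_laurent hI hzw k (hC I hI z hz)

end IsSymmetricSliceDomain

/-! ### The multiplicity of the zeros of the symmetrization -/

/-- Division of a holomorphic function by a power of `z - c`. -/
theorem exists_eq_sub_pow_mul {D : Set ℂ} (ho : IsOpen D) {u : ℂ → ℂ}
    (hu : DifferentiableOn ℂ u D) {c : ℂ} {k : ℕ} {g : ℂ → ℂ} (hg : DifferentiableAt ℂ g c)
    (hug : ∀ᶠ z in nhds c, u z = (z - c) ^ k * g z) :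
    ∃ v : ℂ → ℂ, DifferentiableOn ℂ v D ∧ ∀ z ∈ D, u z = (z - c) ^ k * v z := by
  classical
  have hne : ∀ {z : ℂ}, z ≠ c → (z - c) ^ k ≠ 0 := fun h => pow_ne_zero _ (sub_ne_zero.2 h)
  refine ⟨fun z => if z = c then g c else u z / (z - c) ^ k, fun z hz => ?_, fun z _ => ?_⟩
  · apply DifferentiableAt.differentiableWithinAt
    by_cases hzc : z = c
    · subst hzc
      refine hg.congr_of_eventuallyEq ?_
      filter_upwards [hug] with y hy
      split_ifs with h
      · rw [h]
      · rw [hy, mul_div_cancel_left₀ _ (hne h)]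
    · have : DifferentiableAt ℂ (fun y => u y / (y - c) ^ k) z :=
        (hu.differentiableAt (ho.mem_nhds hz)).div (by fun_prop) (hne hzc)
      refine this.congr_of_eventuallyEq ?_
      filter_upwards [isOpen_ne.mem_nhds hzc] with y hy
      rw [if_neg hy]
  · simp only
    split_ifs with h
    · rw [h, hug.self_of_nhds]
    · rw [mul_div_cancel₀ _ (hne h)]

namespace IsSymmetricSliceDomain

variable {Ω : Set ℍ[ℝ]} {f : ℍ[ℝ] → ℍ[ℝ]}

/-- A holomorphic factor of a conjugation-symmetric function can be chosen to be
conjugation-symmetric. -/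
theorem exists_symmetric_factor (hΩ : IsSymmetricSliceDomain Ω) {u P v : ℂ → ℂ}
    (hu : ∀ z, u (star z) = star (u z)) (hP : ∀ z, P (star z) = star (P z))
    (hv : DifferentiableOn ℂ v (slice Ω unitI)) (huv : ∀ z ∈ slice Ω unitI, u z = P z * v z) :
    ∃ y : ℂ → ℂ, DifferentiableOn ℂ y (slice Ω unitI) ∧ (∀ z, y (star z) = star (y z)) ∧
      ∀ z ∈ slice Ω unitI, u z = P z * y z := by
  -- As `u` and `P` are symmetric, the reflection of `v` is a cofactor as well, and so is the
  -- average.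
  refine ⟨fun z => (v z + star (v (star z))) / 2, ?_, fun z => ?_, fun z hz => ?_⟩
  · exact (hv.add (differentiableOn_star_comp_star hΩ.isOpen_slice_unitI
      (fun z => hΩ.star_mem) hv)).div_const 2
  · simp [add_comm]
  · have h1 := huv z hz
    have h2 := congrArg star (huv _ (hΩ.star_mem hz))
    rw [hu, hP, star_star, star_mul', star_star] at h2
    linear_combination (h1 + h2) / 2

/-- If the symmetrization of `f` vanishes to order `k` along the slice of `p`, it has the factor
`(q - p)^{*k}`, at the level of stem functions. -/
theorem exists_stem_factor (hΩ : IsSymmetricSliceDomain Ω) (hf : IsRegularOn Ω f) {I : ℍ[ℝ]}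
    (hI : I ∈ imagUnits) {w : ℂ} (hw : w ∈ slice Ω unitI) {k : ℕ}
    (hk : analyticOrderAt (stemNorm f) w = k) :
    ∃ S : ℂ → ℍ[ℂ], HolomorphicStemOn S (slice Ω unitI) ∧ (∀ z, S (star z) = conjStem (S z)) ∧
      ∀ z ∈ slice Ω unitI,
        ((z : ℍ[ℂ]) - complexify (slicePoint I w)) ^ k * S z = (stemNorm f z : ℍ[ℂ]) := by
  have ho := hΩ.isOpen_slice_unitI
  have hd := hΩ.differentiableOn_stemNorm hf
  obtain ⟨g, hg, -, heq⟩ := (hΩ.analyticAt_stemNorm hf hw).analyticOrderAt_eq_natCast.1 hk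
  obtain ⟨v, hv, hφv⟩ := exists_eq_sub_pow_mul ho hd hg.differentiableAt heq
  have hcoe : ∀ {y : ℂ → ℂ}, DifferentiableOn ℂ y (slice Ω unitI) →
      HolomorphicStemOn (fun z => (y z : ℍ[ℂ])) (slice Ω unitI) := fun hy => by
    constructor <;> simp [hy]
  by_cases him : w.im = 0
  · obtain ⟨x, rfl⟩ : ∃ x : ℝ, w = x := ⟨w.re, Complex.ext rfl (by simpa using him)⟩
    obtain ⟨y, hy, hys, hφy⟩ := hΩ.exists_symmetric_factor (P := fun z => (z - x) ^ k)
      (stemNorm_star f) (fun z => by simp) hv hφv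
    refine ⟨fun z => (y z : ℍ[ℂ]), hcoe hy, fun z => ?_, fun z hz => ?_⟩
    · simp only [hys]
      ext <;> simp
    · have : ((z : ℍ[ℂ]) - complexify (slicePoint I x)) = ((z - x : ℂ) : ℍ[ℂ]) := by
        rw [slicePoint_ofReal]
        ext <;> simp
      rw [this, hφy z hz, ← Quaternion.coe_pow, ← Quaternion.coe_mul]
  · have hw' := hΩ.star_mem hw
    have hne : star w - w ≠ 0 := by
      intro h
      have := congrArg Complex.im h
      simp at this
      apply him
      linarith
    have hv' := differentiableOn_star_comp_star ho (fun z => hΩ.star_mem) hv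
    -- By symmetry `stemNorm f` is also divisible by `(z - conj w)^k`, and `z - w` does not vanish
    -- near `conj w`, so the cofactor `v` can be divided again. The resulting divisor `((z - w)(z -
    -- conj w))^k` is the norm of `(z - p)^k`.
    obtain ⟨v', hv'', hvv'⟩ := exists_eq_sub_pow_mul ho hv (c := star w) (k := k)
      (g := fun z => star (v (star z)) / (z - w) ^ k)
      ((hv'.differentiableAt (ho.mem_nhds hw')).div (by fun_prop) (pow_ne_zero _ hne)) (by
        have hcont : ContinuousAt (fun z : ℂ => z - w) (star w) := by fun_prop
        filter_upwards [ho.mem_nhds hw', hcont.eventually_ne hne] with z hz hzw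
        have h1 := hφv z hz
        have h2 := congrArg star (hφv _ (hΩ.star_mem hz))
        rw [stemNorm_star, star_star, star_mul', star_pow, star_sub, star_star] at h2
        rw [← mul_div_assoc, ← h2, h1, mul_div_cancel_left₀ _ (pow_ne_zero _ hzw)])
    obtain ⟨y, hy, hys, hφy⟩ := hΩ.exists_symmetric_factor
      (P := fun z => ((z - w) * (z - star w)) ^ k)
      (stemNorm_star f) (fun z => by simp [mul_comm]) hv'' (fun z hz => by
        rw [hφv z hz, hvv' z hz, mul_pow, mul_assoc])
    have hlin : HolomorphicStemOn (fun z => ((z : ℍ[ℂ]) - complexify (slicePoint I w)))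
        (slice Ω unitI) := by
      constructor <;> simp; fun_prop
    have hpow : ∀ n : ℕ, HolomorphicStemOn
        (fun z => ((z : ℍ[ℂ]) - complexify (slicePoint I w)) ^ n) (slice Ω unitI) := by
      intro n
      induction n with
      | zero => simpa using hcoe (differentiableOn_const (1 : ℂ))
      | succ n ih => simpa only [pow_succ] using ih.mul hlin
    -- Multiplying `(z - p)^k` by its conjugate gives its norm, which times `y` is `stemNorm f`.
    refine ⟨fun z => y z • star (((z : ℍ[ℂ]) - complexify (slicePoint I w)) ^ k),
      (hpow k).star.smul hy, fun z => ?_, fun z hz => ?_⟩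
    · dsimp only
      rw [hys, conjStem_smul, conjStem_star, ← stem_starPow, ← stem_starPow, stem_star]
    · dsimp only
      rw [← coe_mul_eq_stem_smul, ← mul_assoc, ← Quaternion.coe_commutes, mul_assoc,
        Quaternion.self_mul_star, map_pow, normSq_coe_sub_complexify hI, ← Quaternion.coe_mul,
        hφy z hz, mul_comm]

/-- On the slice of `p`, a factor `(q - p)^{*n}` acts as `(z - w)^n`; a complex-valued functional
turns the factorization into divisibility of `stemNorm f`, whence `n ≤ k`. Conversely
`exists_stem_factor` provides a cofactor for `n = k`. -/
theorem classicalMultiplicity_symmetrization (hΩ : IsSymmetricSliceDomain Ω)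
    (hf : IsRegularOn Ω f) {I : ℍ[ℝ]} (hI : I ∈ imagUnits) {w : ℂ} (hw : w ∈ slice Ω unitI)
    {k : ℕ} (hk : analyticOrderAt (stemNorm f) w = k) :
    classicalMultiplicity Ω (symmetrization f) (slicePoint I w) = k := by
  apply le_antisymm
  · refine sSup_le ?_
    rintro N ⟨n, rfl, h, hh, hfac⟩
    rw [← hk, natCast_le_analyticOrderAt (hΩ.analyticAt_stemNorm hf hw)]
    have hd := (hΩ.holomorphicStemOn hh).sliceFunctional hI 1
    refine ⟨_, hd.analyticOnNhd hΩ.isOpen_slice_unitI w hw, ?_⟩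
    filter_upwards [hΩ.isOpen_slice_unitI.mem_nhds hw] with z hz
    have h1 := congrArg (sliceFunctional I 1) (hfac _ ((hΩ.slicePoint_mem hI).2 hz))
    rw [symmetrization_slicePoint f hI, starProd_slicePoint _ _ hI, stem_starPow,
      evalStem_sub_pow_mul hI, sliceFunctional_slicePoint_mul hI,
      ← mul_one (slicePoint I (stemNorm f z)), sliceFunctional_slicePoint_mul hI] at h1
    have h2 : sliceFunctional I 1 1 = 1 := by
      rw [sliceFunctional_apply]
      apply Complex.ext <;> simp [(mem_imagUnits_iff.1 hI).1]
    rwa [h2, mul_one] at h1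
  · refine le_sSup ⟨k, rfl, ?_⟩
    obtain ⟨S, hS, hSs, hfac⟩ := hΩ.exists_stem_factor hf hI hw hk
    have hev : ∀ J ∈ imagUnits, ∀ z,
        regularExt (fun z => evalStem unitI (S z)) (slicePoint J z) = evalStem J (S z) :=
      fun J hJ z => regularExt_slicePoint (fun _ => rfl) hSs hJ z
    refine ⟨regularExt fun z => evalStem unitI (S z), ?_, ?_⟩
    · refine isRegularOn_of_stem hΩ.isOpen_slice (fun J hJ => ?_) fun J hJ z _ => hev J hJ z
      rwa [hΩ.slice_eq hJ]
    · intro q hq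
      obtain ⟨J, hJ, hJq⟩ := exists_slicePoint_eq q
      rw [← hJq] at hq ⊢
      rw [symmetrization_slicePoint f hJ, starProd_slicePoint _ _ hJ, stem_starPow,
        stem_eq_of_eval (hev _ unitI_mem _) (by rw [hev _ unitI_mem, hSs]),
        hfac _ ((hΩ.slicePoint_mem hJ).1 hq), evalStem_coe]

theorem analyticOrderAt_stemNorm_ne_top (hΩ : IsSymmetricSliceDomain Ω) (hf : IsRegularOn Ω f)
    (hf0 : ∃ q ∈ Ω, f q ≠ 0) {w : ℂ} (hw : w ∈ slice Ω unitI) :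
    analyticOrderAt (stemNorm f) w ≠ ⊤ := by
  obtain ⟨r, hr, hr0⟩ := hΩ.exists_real_stemNorm_ne_zero hf hf0
  have ha := (hΩ.differentiableOn_stemNorm hf).analyticOnNhd hΩ.isOpen_slice_unitI
  refine AnalyticOnNhd.analyticOrderAt_ne_top_of_isPreconnected ha
    (hΩ.isConnected_slice _ unitI_mem).isPreconnected hr hw ?_
  rw [(ha r hr).analyticOrderAt_eq_zero.2 hr0]
  exact ENat.zero_ne_top

end IsSymmetricSliceDomain

end SliceRegular
end

theorem mainTheorem8 (Ω : Set (Quaternion ℝ)) (hΩ : SliceRegular.IsSymmetricSliceDomain Ω)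
    (f g : Quaternion ℝ → Quaternion ℝ)
    (hf : SliceRegular.IsRegularOn Ω f) (hg : SliceRegular.IsRegularOn Ω g)
    (hf0 : ∃ q ∈ Ω, f q ≠ 0) :
    (∀ p ∈ SliceRegular.zeroSet Ω (SliceRegular.symmetrization f),
      SliceRegular.IsPole (Ω \ SliceRegular.zeroSet Ω (SliceRegular.symmetrization f))
        (SliceRegular.starQuotient f g) p ∧
      SliceRegular.poleOrder (Ω \ SliceRegular.zeroSet Ω (SliceRegular.symmetrization f))
        (SliceRegular.starQuotient f g) p
        ≤ SliceRegular.classicalMultiplicity Ω (SliceRegular.symmetrization f) p ∧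
      SliceRegular.classicalMultiplicity Ω (SliceRegular.symmetrization f) p < ⊤) ∧
    SliceRegular.IsSemiregularIn Ω
      (Ω \ SliceRegular.zeroSet Ω (SliceRegular.symmetrization f))
      (SliceRegular.starQuotient f g) := by
  have main : ∀ p ∈ Ω, ∃ k : ℕ,
      SliceRegular.IsPoleOfOrderLE (Ω \ SliceRegular.zeroSet Ω (SliceRegular.symmetrization f))
        (SliceRegular.starQuotient f g) p k ∧
      SliceRegular.classicalMultiplicity Ω (SliceRegular.symmetrization f) p = k := by
    intro p hp
    obtain ⟨I, hI, hIp⟩ := SliceRegular.exists_slicePoint_eq p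
    rw [← hIp] at hp ⊢
    have hw := (hΩ.slicePoint_mem hI).1 hp
    obtain ⟨k, hk⟩ := ENat.ne_top_iff_exists.1 (hΩ.analyticOrderAt_stemNorm_ne_top hf hf0 hw)
    exact ⟨k, hΩ.isPoleOfOrderLE hf hg hI hw hk.symm,
      hΩ.classicalMultiplicity_symmetrization hf hI hw hk.symm⟩
  refine ⟨fun p hp => ?_, fun q hq => hq.1, hΩ.diff_zeroSet hf hf0,
    hΩ.isRegularOn_starQuotient hf hf0 hg, fun p hp => ?_⟩
  · obtain ⟨k, hpole, hmult⟩ := main p hp.1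
    rw [hmult]
    exact ⟨⟨k, hpole⟩, sInf_le ⟨k, rfl, hpole⟩, ENat.natCast_lt_top k⟩
  · obtain ⟨k, hpole, -⟩ := main p hp.1
    exact Or.inl ⟨k, hpole⟩
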